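/- Let $\mathcal K$ be an abstract elementary class (with strong substructure relation $\prec_{\mathcal K}$) which satisfies the amalgamation property and the joint embedding property, and let $\mu\ge \mathrm{LS}(\mathcal K)$ be a cardinal. Write $\mathcal K_\kappa$ for the class of models in $\mathcal K$ of cardinality $\kappa$. Suppose that $\mathcal K$ is Galois-stable in $\mu^+$ (that is, over every $M\in\mathcal K_{\mu^+}$ there are at most $\mu^+$ Galois types) and that $\mathcal K$ has no maximal model of cardinality $\mu^+$ (that is, every $M\in\mathcal K_{\mu^+}$ has a proper $\prec_{\mathcal K}$-extension in $\mathcal K$). Then every $(\mu,\mu^+)$-limit model is a $(\mu^+,\mu^+)$-limit model. Here, for a cardinal $\kappa$, a model $N\in\mathcal K_\kappa$ is universal over $M\in\mathcal K_\kappa$ if $M\prec_{\mathcal K}N$ and every $N'\in\mathcal K_\kappa$ with $M\prec_{\mathcal K}N'$ has a $\mathcal K$-embedding into $N$ fixing $M$ pointwise; and for a limit ordinal $\theta$, $M$ is a $(\kappa,\theta)$-limit model if $M=\bigcup_{i<\theta}M_i$ for some strictly $\prec_{\mathcal K}$-increasing and continuous sequence $\langle M_i\in\mathcal K_\kappa\mid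 i<\theta\rangle$ such that $M_{i+1}$ is universal over $M_i$ for every $i<\theta$. -/

import Mathlib

open FirstOrder

universe u

/-- An abstract elementary class in the language `L`: a class `K` of `L`-structures (`Mem`)
together with the strong substructure relation (`Strong S` says `S ≺_K N`, for a substructure
`S` of the structure `N`; the case `S = N` is allowed).  For substructures `S ≤ T` of a common
structure, `S ≺_K T` is expressed by viewing `S` as a substructure of `T`. -/
structure AEC (L : FirstOrder.Language.{u, u}) where
  /-- membership in the class `K` -/
  Mem : ∀ (M : Type u) [L.Structure M], Prop
  /-- the relation `S ≺_K N` for a substructure `S` of `N` -/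
  Strong : ∀ {N : Type u} [L.Structure N], L.Substructure N → Prop
  /-- `≺_K` is a relation on `K` -/
  mem_of_strong : ∀ {N : Type u} [L.Structure N] (S : L.Substructure N),
    Strong S → Mem N ∧ Mem S
  /-- `K` is closed under isomorphism -/
  mem_iso : ∀ {M N : Type u} [L.Structure M] [L.Structure N], (M ≃[L] N) → Mem M → Mem N
  /-- `≺_K` is closed under isomorphism -/
  strong_iso : ∀ {M N : Type u} [L.Structure M] [L.Structure N] (e : M ≃[L] N)
    (S : L.Substructure M), Strong S → Strong (S.map e.toHom)
  /-- `≺_K` is reflexive on `K` -/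
  strong_refl : ∀ {N : Type u} [L.Structure N], Mem N → Strong (⊤ : L.Substructure N)
  /-- `≺_K` is transitive -/
  strong_trans : ∀ {N : Type u} [L.Structure N] (S T : L.Substructure N), S ≤ T →
    Strong (S.comap T.subtype.toHom) → Strong T → Strong S
  /-- coherence -/
  coherence : ∀ {N : Type u} [L.Structure N] (S T : L.Substructure N), S ≤ T →
    Strong S → Strong T → Strong (S.comap T.subtype.toHom)
  /-- Tarski–Vaught chain axiom: the union of a `≺_K`-increasing chain is in `K` and is a
  `≺_K`-extension of every member of the chain -/
  chain_union : ∀ {P : Type u} [L.Structure P] (δ : Ordinal.{u}), Order.IsSuccLimit δ →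
    ∀ S : Ordinal.{u} → L.Substructure P,
      (∀ i j, i < j → j < δ → S i ≤ S j ∧ Strong ((S i).comap (S j).subtype.toHom)) →
      (⋃ i ∈ Set.Iio δ, (S i : Set P)) = Set.univ →
      Mem P ∧ ∀ i < δ, Strong (S i)
  /-- Tarski–Vaught chain axiom: if all members of a `≺_K`-increasing chain are strong in `N`,
  then so is its union -/
  chain_strong : ∀ {N : Type u} [L.Structure N] (δ : Ordinal.{u}), Order.IsSuccLimit δ →
    ∀ (S : Ordinal.{u} → L.Substructure N) (T : L.Substructure N),
      (∀ i j, i < j → j < δ → S i ≤ S j ∧ Strong ((S i).comap (S j).subtype.toHom)) →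
      (∀ i < δ, Strong (S i)) →
      (T : Set N) = (⋃ i ∈ Set.Iio δ, (S i : Set N)) →
      Strong T
  /-- Löwenheim–Skolem axiom -/
  exists_LS : ∃ κ : Cardinal.{u}, Cardinal.aleph0 ≤ κ ∧ L.card ≤ κ ∧
    ∀ (N : Type u) [L.Structure N], Mem N → ∀ A : Set N,
      ∃ S : L.Substructure N, Strong S ∧ A ⊆ S ∧ Cardinal.mk S ≤ Cardinal.mk A + κ

namespace AEC

variable {L : FirstOrder.Language.{u, u}} (K : AEC L)

/-- The Löwenheim–Skolem number `LS(K)`: the least infinite cardinal `κ ≥ |L|` such that every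
subset `A` of a model `N` is contained in some `S ≺_K N` with `‖S‖ ≤ |A| + κ`. -/
noncomputable def LS : Cardinal.{u} :=
  sInf {κ : Cardinal.{u} | Cardinal.aleph0 ≤ κ ∧ L.card ≤ κ ∧
    ∀ (N : Type u) [L.Structure N], K.Mem N → ∀ A : Set N,
      ∃ S : L.Substructure N, K.Strong S ∧ A ⊆ S ∧ Cardinal.mk S ≤ Cardinal.mk A + κ}

/-- `f : M → N` is a `K`-embedding: an embedding of structures (both in `K`) with
`f[M] ≺_K N`. -/
def IsKEmbedding {M N : Type u} [L.Structure M] [L.Structure N] (f : M ↪[L] N) : Prop :=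
  K.Mem M ∧ K.Strong f.toHom.range

/-- The amalgamation property. -/
def AmalgamationProperty : Prop :=
  ∀ (M₀ M₁ M₂ : Type u) [L.Structure M₀] [L.Structure M₁] [L.Structure M₂]
    (f₁ : M₀ ↪[L] M₁) (f₂ : M₀ ↪[L] M₂), K.IsKEmbedding f₁ → K.IsKEmbedding f₂ →
    ∃ (N : Type u) (_ : L.Structure N) (g₁ : M₁ ↪[L] N) (g₂ : M₂ ↪[L] N),
      K.IsKEmbedding g₁ ∧ K.IsKEmbedding g₂ ∧ g₁.comp f₁ = g₂.comp f₂

/-- The joint embedding property. -/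
def JointEmbeddingProperty : Prop :=
  ∀ (M₁ M₂ : Type u) [L.Structure M₁] [L.Structure M₂], K.Mem M₁ → K.Mem M₂ →
    ∃ (N : Type u) (_ : L.Structure N) (g₁ : M₁ ↪[L] N) (g₂ : M₂ ↪[L] N),
      K.IsKEmbedding g₁ ∧ K.IsKEmbedding g₂

/-- `K` has no maximal model of cardinality `κ`: every model of cardinality `κ` has a proper
`≺_K`-extension. -/
def NoMaximalModel (κ : Cardinal.{u}) : Prop :=
  ∀ (M : Type u) [L.Structure M], K.Mem M → Cardinal.mk M = κ →
    ∃ (N : Type u) (_ : L.Structure N) (f : M ↪[L] N),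
      K.IsKEmbedding f ∧ ¬ Function.Surjective f

/-- A triple `(M, N, a)` with `M ≺_K N` and `a ∈ N`, the extension being given by a
`K`-embedding of `M` into `N`. -/
structure PointedExt (M : Type u) [L.Structure M] where
  N : Type u
  [str : L.Structure N]
  emb : M ↪[L] N
  isK : K.IsKEmbedding emb
  pt : N

attribute [instance] PointedExt.str

/-- `(M, N₁, a₁)` and `(M, N₂, a₂)` are related if `N₁`, `N₂` can be amalgamated over `M` so that
`a₁`, `a₂` are identified. -/
def GaloisRel (M : Type u) [L.Structure M] (p q : K.PointedExt M) : Prop :=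
  ∃ (N : Type u) (_ : L.Structure N) (g : p.N ↪[L] N) (h : q.N ↪[L] N),
    K.IsKEmbedding g ∧ K.IsKEmbedding h ∧ g.comp p.emb = h.comp q.emb ∧ g p.pt = h q.pt

/-- The set `ga-S(M)` of Galois types over `M`: the quotient of the triples `(M, N, a)` by the
equivalence relation generated by `GaloisRel`. -/
def GaloisTypes (M : Type u) [L.Structure M] : Type (u + 1) :=
  Quot (K.GaloisRel M)

/-- `K` is Galois-stable in `κ`: there are at most `κ` Galois types over each model of
cardinality `κ`. -/
def GaloisStable (κ : Cardinal.{u}) : Prop :=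
  ∀ (M : Type u) [L.Structure M], K.Mem M → Cardinal.mk M = κ →
    Cardinal.mk (K.GaloisTypes M) ≤ Cardinal.lift.{u + 1} κ

/-- For `f : M → N` (usually an inclusion): `N` is universal over `M` via `f`, that is `f` is a
`K`-embedding, `‖M‖ = ‖N‖`, and every `≺_K`-extension `N'` of `M` with `‖N'‖ = ‖M‖`
`K`-embeds into `N` over `M`. -/
def IsUniversalExt {M N : Type u} [L.Structure M] [L.Structure N] (f : M ↪[L] N) : Prop :=
  K.IsKEmbedding f ∧ Cardinal.mk M = Cardinal.mk N ∧
    ∀ (N' : Type u) [L.Structure N'] (h : M ↪[L] N'), K.IsKEmbedding h →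
      Cardinal.mk N' = Cardinal.mk M →
      ∃ g : N' ↪[L] N, K.IsKEmbedding g ∧ g.comp h = f

/-- `M` is a `(μ, θ)`-limit model: `θ` is a limit ordinal and `M = ⋃_{i<θ} M_i` for a (strictly)
`≺_K`-increasing and continuous sequence of models `M_i ∈ K_μ`, `i < θ`, with `M_{i+1}`
universal over `M_i` for each `i < θ`. Only the values `S i` with `i < θ` matter. -/
def IsLimitModel (μ : Cardinal.{u}) (θ : Ordinal.{u}) (M : Type u) [L.Structure M] : Prop :=
  Order.IsSuccLimit θ ∧ ∃ S : Ordinal.{u} → L.Substructure M,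
    (∀ i < θ, K.Mem (S i) ∧ Cardinal.mk (S i) = μ) ∧
    (∀ i j, i < j → j < θ → S i < S j ∧ K.Strong ((S i).comap (S j).subtype.toHom)) ∧
    (∀ i < θ, Order.IsSuccLimit i → (S i : Set M) = ⋃ j ∈ Set.Iio i, (S j : Set M)) ∧
    (∀ i < θ, ∃ h : S i ≤ S (Order.succ i),
      K.IsUniversalExt (FirstOrder.Language.Substructure.inclusion h)) ∧
    (⋃ i ∈ Set.Iio θ, (S i : Set M)) = Set.univ

end AEC

open Cardinal Order Ordinal Set

/-! A model is called model homogeneous here if any `K`-embedding of a small model `A` into it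
extends along every strong extension `B` of `A` with at most `μ` elements. A limit model of length
`μ⁺`, with steps of size `μ` or `μ⁺`, has this property: by regularity of `μ⁺` the image of `A` lies
in one member `M_j` of the chain, and an amalgam of `M_j` with `B` maps into `M_{j+1}` over `M_j` by
universality (`IsLimitModel.isModelHomogeneous`). Such a limit model also has exactly `μ⁺` elements
(`IsLimitModel.card_eq`).

With joint embedding to start it, a back-and-forth of length `μ⁺` shows that two model homogeneous
models of size `μ⁺` are isomorphic (`IsModelHomogeneous.nonempty_equiv`). Being a limit model is
invariant under isomorphism, so it remains to produce one `(μ⁺, μ⁺)`-limit model.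

This is where stability enters (`exists_isLimitModel`). In a stable cardinal `κ` one extension of
size `κ` realizes all types over a given model. Iterating this `κ` times gives a universal extension
(`universal_of_type_chain`), and iterating universal extensions `κ` times gives a limit model. The
absence of maximal models makes the last chain strictly increasing. -/

namespace AEC

/-! ### `K`-embeddings, coherence and Löwenheim–Skolem -/

section Basics

variable {L : FirstOrder.Language.{u, u}} {K : AEC L}
variable {A B C N : Type u} [L.Structure A] [L.Structure B] [L.Structure C] [L.Structure N]

theorem strong_mono_iso (e : A ≃[L] B) (S : L.Substructure A) (T : L.Substructure B)
    (h : ∀ x, x ∈ S ↔ e x ∈ T) : K.Strong S ↔ K.Strong T := by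
  have h1 : S.map e.toHom = T := by
    ext y
    rw [FirstOrder.Language.Substructure.mem_map]
    constructor
    · rintro ⟨x, hx, rfl⟩
      exact (h x).1 hx
    · intro hy
      refine ⟨e.symm y, (h _).2 (by simpa using hy), ?_⟩
      exact e.apply_symm_apply y
  have h2 : T.map e.symm.toHom = S := by
    ext y
    rw [FirstOrder.Language.Substructure.mem_map]
    constructor
    · rintro ⟨x, hx, rfl⟩
      refine (h _).2 ?_
      have : e (e.symm x) = x := e.apply_symm_apply x
      exact this.symm ▸ hx
    · intro hy
      exact ⟨e y, (h _).1 hy, e.symm_apply_apply y⟩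
  exact ⟨fun hS => h1 ▸ K.strong_iso e S hS, fun hT => h2 ▸ K.strong_iso e.symm T hT⟩

theorem IsKEmbedding.mem_left {f : A ↪[L] B} (h : K.IsKEmbedding f) : K.Mem A := h.1

theorem IsKEmbedding.mem_right {f : A ↪[L] B} (h : K.IsKEmbedding f) : K.Mem B :=
  (K.mem_of_strong _ h.2).1

theorem isKEmbedding_equiv (e : A ≃[L] B) (h : K.Mem A) : K.IsKEmbedding e.toEmbedding := by
  refine ⟨h, ?_⟩
  have : e.toEmbedding.toHom.range = ⊤ :=
    FirstOrder.Language.Hom.range_eq_top.2 e.surjective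
  rw [this]
  exact K.strong_refl (K.mem_iso e h)

theorem isKEmbedding_refl (h : K.Mem A) :
    K.IsKEmbedding (FirstOrder.Language.Embedding.refl L A) :=
  isKEmbedding_equiv (FirstOrder.Language.Equiv.refl L A) h

theorem mem_range_embedding (f : A ↪[L] B) {y : B} : y ∈ f.toHom.range ↔ ∃ x, f x = y :=
  FirstOrder.Language.Hom.mem_range

/-- The strength of a subset of `A` can be tested in any embedded copy of `A`. -/
theorem strong_comap_range (f : A ↪[L] N) (S : L.Substructure A) (T : L.Substructure N)
    (h : ∀ x, x ∈ S ↔ f x ∈ T) :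
    K.Strong (T.comap f.toHom.range.subtype.toHom) ↔ K.Strong S := by
  refine (strong_mono_iso f.equivRange _ _ fun x => ?_).symm
  rw [h x]
  exact Iff.rfl

/-- Transports a `K`-embedding of abstract models into the form used by the axioms of `AEC`, which
speak of two substructures of a common structure. The ambient embedding `d` need not be strong. -/
theorem IsKEmbedding.strong_comap {h : A ↪[L] B} (hh : K.IsKEmbedding h) (d : B ↪[L] N) :
    K.Strong ((d.comp h).toHom.range.comap d.toHom.range.subtype.toHom) := by
  refine (strong_comap_range d h.toHom.range _ fun x => ?_).2 hh.2
  rw [mem_range_embedding, mem_range_embedding]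
  exact ⟨fun ⟨a, ha⟩ => ⟨a, congrArg d ha⟩, fun ⟨a, ha⟩ => ⟨a, d.injective ha⟩⟩

theorem range_comp_le (d : B ↪[L] N) (h : A ↪[L] B) :
    (d.comp h).toHom.range ≤ d.toHom.range := by
  intro y hy
  obtain ⟨a, rfl⟩ := (mem_range_embedding _).1 hy
  exact (mem_range_embedding _).2 ⟨h a, rfl⟩

theorem IsKEmbedding.comp {g : B ↪[L] C} {f : A ↪[L] B} (hg : K.IsKEmbedding g)
    (hf : K.IsKEmbedding f) : K.IsKEmbedding (g.comp f) :=
  ⟨hf.1, K.strong_trans _ g.toHom.range (range_comp_le g f) (hf.strong_comap g) hg.2⟩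

theorem isKEmbedding_subtype {S : L.Substructure N} (h : K.Strong S) :
    K.IsKEmbedding S.subtype := by
  refine ⟨(K.mem_of_strong S h).2, ?_⟩
  have : S.subtype.toHom.range = S := FirstOrder.Language.Substructure.range_subtype S
  rwa [this]

/-- An embedding whose range lies in the range of another one factors through it. -/
theorem exists_factor (f : A ↪[L] N) (e : B ↪[L] N) (h : ∀ b, ∃ a, f a = e b) :
    ∃ g : B ↪[L] A, f.comp g = e := by
  refine ⟨f.equivRange.symm.toEmbedding.comp
    (FirstOrder.Language.Embedding.codRestrict f.toHom.range e
      fun b => (mem_range_embedding f).2 (h b)), ?_⟩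
  ext b
  have h1 := f.equivRange_apply (f.equivRange.symm
    (FirstOrder.Language.Embedding.codRestrict f.toHom.range e
      (fun b => (mem_range_embedding f).2 (h b)) b))
  rw [f.equivRange.apply_symm_apply] at h1
  exact h1.symm

theorem IsKEmbedding.of_comp {f : A ↪[L] N} {g : B ↪[L] A} (hf : K.IsKEmbedding f)
    (he : K.IsKEmbedding (f.comp g)) : K.IsKEmbedding g := by
  refine ⟨he.1, ?_⟩
  refine (strong_comap_range f g.toHom.range (f.comp g).toHom.range fun x => ?_).1
    (K.coherence _ _ (range_comp_le f g) he.2 hf.2)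
  rw [mem_range_embedding, mem_range_embedding]
  exact ⟨fun ⟨a, ha⟩ => ⟨a, congrArg f ha⟩, fun ⟨a, ha⟩ => ⟨a, f.injective ha⟩⟩

/-- Coherence, in terms of embeddings. -/
theorem IsKEmbedding.exists_factor {f : A ↪[L] N} {e : B ↪[L] N} (hf : K.IsKEmbedding f)
    (he : K.IsKEmbedding e) (h : ∀ b, ∃ a, f a = e b) :
    ∃ g : B ↪[L] A, K.IsKEmbedding g ∧ f.comp g = e := by
  obtain ⟨g, hg⟩ := AEC.exists_factor f e h
  exact ⟨g, hf.of_comp (hg ▸ he), hg⟩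

theorem card_le_of_embedding (f : A ↪[L] B) : #A ≤ #B :=
  Cardinal.mk_le_of_injective f.injective

/-- The Löwenheim–Skolem property holds at every cardinal above `LS(K)`. -/
theorem LS_spec (K : AEC L) : ℵ₀ ≤ K.LS ∧ ∀ (N : Type u) [L.Structure N], K.Mem N → ∀ A : Set N,
      ∃ S : L.Substructure N, K.Strong S ∧ A ⊆ S ∧ #S ≤ #A + K.LS := by
  have h := csInf_mem (s := {κ : Cardinal.{u} | Cardinal.aleph0 ≤ κ ∧ L.card ≤ κ ∧
    ∀ (N : Type u) [L.Structure N], K.Mem N → ∀ A : Set N,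
      ∃ S : L.Substructure N, K.Strong S ∧ A ⊆ S ∧ Cardinal.mk S ≤ Cardinal.mk A + κ}) K.exists_LS
  exact ⟨h.1, h.2.2⟩

theorem exists_small_model {ν : Cardinal.{u}} (hν : K.LS ≤ ν) (hN : K.Mem N) (X : Set N)
    (hX : #X ≤ ν) : ∃ (W : Type u) (_ : L.Structure W) (j : W ↪[L] N),
      K.IsKEmbedding j ∧ #W ≤ ν ∧ ∀ x ∈ X, ∃ w, j w = x := by
  obtain ⟨S, hS, hXS, hc⟩ := (LS_spec K).2 N hN X
  refine ⟨S, inferInstance, S.subtype, isKEmbedding_subtype hS, ?_, fun x hx => ⟨⟨x, hXS hx⟩, rfl⟩⟩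
  exact hc.trans (Cardinal.add_le_of_le ((LS_spec K).1.trans hν) hX hν)

/-- Amalgamation within models of size at most `ν`. -/
theorem exists_small_amalgam (hAP : K.AmalgamationProperty) {ν : Cardinal.{u}} (hν : K.LS ≤ ν)
    {f : A ↪[L] B} {g : A ↪[L] C} (hf : K.IsKEmbedding f) (hg : K.IsKEmbedding g)
    (hB : #B ≤ ν) (hC : #C ≤ ν) :
    ∃ (W : Type u) (_ : L.Structure W) (i : B ↪[L] W) (j : C ↪[L] W),
      K.IsKEmbedding i ∧ K.IsKEmbedding j ∧ #W ≤ ν ∧ i.comp f = j.comp g := by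
  obtain ⟨W', _, i', j', hi', hj', hij⟩ := hAP A B C f g hf hg
  obtain ⟨W, _, k, hk, hW, hX⟩ := exists_small_model hν hi'.mem_right
    (range i' ∪ range j') ((Cardinal.mk_union_le _ _).trans
      (Cardinal.add_le_of_le ((LS_spec K).1.trans hν) (Cardinal.mk_range_le.trans hB)
        (Cardinal.mk_range_le.trans hC)))
  obtain ⟨i, hi, hik⟩ := hk.exists_factor hi' fun b => hX _ (Or.inl ⟨b, rfl⟩)
  obtain ⟨j, hj, hjk⟩ := hk.exists_factor hj' fun b => hX _ (Or.inr ⟨b, rfl⟩)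
  refine ⟨W, _, i, j, hi, hj, hW, ?_⟩
  ext a
  apply k.injective
  have h1 := DFunLike.congr_fun hij a
  rw [← hik, ← hjk] at h1
  exact h1

/-- Joint embedding within models of size at most `ν`. -/
theorem exists_small_joint (hJEP : K.JointEmbeddingProperty) {ν : Cardinal.{u}} (hν : K.LS ≤ ν)
    (hmB : K.Mem B) (hmC : K.Mem C) (hB : #B ≤ ν) (hC : #C ≤ ν) :
    ∃ (W : Type u) (_ : L.Structure W) (i : B ↪[L] W) (j : C ↪[L] W),
      K.IsKEmbedding i ∧ K.IsKEmbedding j ∧ #W ≤ ν := by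
  obtain ⟨W', _, i', j', hi', hj'⟩ := hJEP B C hmB hmC
  obtain ⟨W, _, k, hk, hW, hX⟩ := exists_small_model hν hi'.mem_right
    (range i' ∪ range j') ((Cardinal.mk_union_le _ _).trans
      (Cardinal.add_le_of_le ((LS_spec K).1.trans hν) (Cardinal.mk_range_le.trans hB)
        (Cardinal.mk_range_le.trans hC)))
  obtain ⟨i, hi, -⟩ := hk.exists_factor hi' fun b => hX _ (Or.inl ⟨b, rfl⟩)
  obtain ⟨j, hj, -⟩ := hk.exists_factor hj' fun b => hX _ (Or.inr ⟨b, rfl⟩)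
  exact ⟨W, _, i, j, hi, hj, hW⟩

end Basics

/-! ### Galois types under amalgamation -/

section GaloisTypes

variable {L : FirstOrder.Language.{u, u}} {K : AEC L} {M : Type u} [L.Structure M]

/-- Only transitivity needs amalgamation: the two witnessing models are amalgamated over the middle
one. Hence equal types are witnessed by a single amalgam, with no zigzag. -/
theorem galoisRel_equivalence (hAP : K.AmalgamationProperty) :
    Equivalence (K.GaloisRel M) where
  refl p := ⟨p.N, _, .refl L _, .refl L _, isKEmbedding_refl p.isK.mem_right,
    isKEmbedding_refl p.isK.mem_right, rfl, rfl⟩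
  symm := by
    rintro p q ⟨N, _, g, h, hg, hh, e1, e2⟩
    exact ⟨N, _, h, g, hh, hg, e1.symm, e2.symm⟩
  trans := by
    rintro p q r ⟨N, _, g, h, hg, hh, e1, e2⟩ ⟨N', _, g', h', hg', hh', e1', e2'⟩
    obtain ⟨W, _, i, j, hi, hj, hij⟩ := hAP q.N N N' h g' hh hg'
    refine ⟨W, _, i.comp g, j.comp h', hi.comp hg, hj.comp hh', ?_, ?_⟩
    · ext a
      have h1 := DFunLike.congr_fun e1 a
      have h2 := DFunLike.congr_fun e1' a
      have h3 := DFunLike.congr_fun hij (q.emb a)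
      simp only [FirstOrder.Language.Embedding.comp_apply] at *
      rw [h1, h3, h2]
    · have h3 := DFunLike.congr_fun hij q.pt
      simp only [FirstOrder.Language.Embedding.comp_apply] at *
      rw [e2, h3, e2']

theorem galoisRel_of_mk_eq (hAP : K.AmalgamationProperty) {p q : K.PointedExt M}
    (h : (Quot.mk _ p : K.GaloisTypes M) = Quot.mk _ q) : K.GaloisRel M p q :=
  ((galoisRel_equivalence hAP).quot_mk_eq_iff p q).1 h

theorem galoisType_comp {A B : Type u} [L.Structure A] [L.Structure B] {f : M ↪[L] A}
    (hf : K.IsKEmbedding f) {g : A ↪[L] B} (hg : K.IsKEmbedding g) (a : A) :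
    (Quot.mk _ ⟨A, f, hf, a⟩ : K.GaloisTypes M) = Quot.mk _ ⟨B, g.comp f, hg.comp hf, g a⟩ :=
  Quot.sound ⟨B, _, g, .refl L _, hg, isKEmbedding_refl hg.mem_right, rfl, rfl⟩

end GaloisTypes

/-! ### Unions of chains, for structures and for `K`-embeddings -/

section Glue

variable {L : FirstOrder.Language.{u, u}} {ι : Type*} [LinearOrder ι] [Nonempty ι]
variable {A : ι → Type u} [∀ i, L.Structure (A i)]

theorem exists_stage {D : Type u} (d : ∀ i, A i → D)
    (hd : ∀ i j, i ≤ j → ∀ a, ∃ b, d j b = d i a) (hsurj : ∀ x, ∃ i a, d i a = x)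
    {n : ℕ} (x : Fin n → D) : ∃ i, ∃ a : Fin n → A i, d i ∘ a = x := by
  choose k a hka using hsurj
  obtain ⟨m, hm⟩ := (Set.finite_range fun t => k (x t)).bddAbove
  choose b hb using fun t => hd (k (x t)) m (hm ⟨t, rfl⟩) (a (x t))
  exact ⟨m, b, funext fun t => (hb t).trans (hka _)⟩

/-- A directed union of structures carries a structure. -/
theorem exists_union_structure {D : Type u} (d : ∀ i, A i → D)
    (hinj : ∀ i, Function.Injective (d i))
    (hd : ∀ i j, i ≤ j → ∃ h : A i ↪[L] A j, ∀ a, d j (h a) = d i a)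
    (hsurj : ∀ x, ∃ i a, d i a = x) :
    ∃ (_ : L.Structure D), ∀ i, ∃ e : A i ↪[L] D, ∀ a, e a = d i a := by
  choose k hk using hd
  have hst : ∀ {n : ℕ} (x : Fin n → D), ∃ i, ∃ a : Fin n → A i, d i ∘ a = x :=
    fun x => exists_stage d (fun i j hij a => ⟨k i j hij a, hk i j hij a⟩) hsurj x
  choose s t hst using @hst
  -- Functions and relations can be computed at any stage containing the tuple: two stages are
  -- compared inside the larger one. This makes the arbitrary stage `s x` in `str` harmless.
  have key : ∀ i j {n : ℕ} (a : Fin n → A i) (b : Fin n → A j), d i ∘ a = d j ∘ b →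
      (∀ f : L.Functions n, d i (FirstOrder.Language.Structure.funMap f a) =
        d j (FirstOrder.Language.Structure.funMap f b)) ∧
      (∀ r : L.Relations n, FirstOrder.Language.Structure.RelMap r a ↔
        FirstOrder.Language.Structure.RelMap r b) := by
    intro i j n a b hab
    have h1 : k i (max i j) (le_max_left _ _) ∘ a = k j (max i j) (le_max_right _ _) ∘ b := by
      funext t
      apply hinj (max i j)
      simpa [hk] using congrFun hab t
    constructor
    · intro f
      rw [← hk i _ (le_max_left i j), ← hk j _ (le_max_right i j),
        FirstOrder.Language.Embedding.map_fun, FirstOrder.Language.Embedding.map_fun, h1]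
    · intro r
      rw [← (k i _ (le_max_left i j)).map_rel, ← (k j _ (le_max_right i j)).map_rel, h1]
  let str : L.Structure D :=
    { funMap := fun {n} f x => d (s x) (FirstOrder.Language.Structure.funMap f (t x))
      RelMap := fun {n} r x => FirstOrder.Language.Structure.RelMap r (t x) }
  refine ⟨str, fun i => ⟨{ toFun := d i, inj' := hinj i, map_fun' := ?_, map_rel' := ?_ },
    fun _ => rfl⟩⟩
  · intro n f x
    exact (key _ _ _ _ (hst (d i ∘ x)).symm).1 f
  · intro n r x
    exact ((key _ _ _ _ (hst (d i ∘ x)).symm).2 r).symm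

/-- Compatible embeddings of the members of a directed union glue to an embedding of the union. -/
theorem exists_glue {D Y : Type u} [L.Structure D] [L.Structure Y] (d : ∀ i, A i ↪[L] D)
    (g : ∀ i, A i ↪[L] Y)
    (hd : ∀ i j, i ≤ j → ∃ h : A i ↪[L] A j, (∀ a, d j (h a) = d i a) ∧ ∀ a, g j (h a) = g i a)
    (hsurj : ∀ x, ∃ i a, d i a = x) :
    ∃ f : D ↪[L] Y, ∀ i a, f (d i a) = g i a := by
  choose k hkd hkg using hd
  choose s t hst using hsurj
  have hsame : ∀ i j (a : A i) (b : A j), d i a = d j b ↔ g i a = g j b := by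
    intro i j a b
    rw [← hkd i _ (le_max_left i j), ← hkd j _ (le_max_right i j),
      ← hkg i _ (le_max_left i j), ← hkg j _ (le_max_right i j),
      (d _).injective.eq_iff, (g _).injective.eq_iff]
  let F : D → Y := fun x => g (s x) (t x)
  have hF : ∀ i a, F (d i a) = g i a := fun i a => (hsame _ _ _ _).1 (hst _)
  have hstage : ∀ {n : ℕ} (x : Fin n → D), ∃ i, ∃ a : Fin n → A i, d i ∘ a = x :=
    fun x => exists_stage (fun i => d i) (fun i j hij a => ⟨k i j hij a, hkd i j hij a⟩)
      (fun x => ⟨s x, t x, hst x⟩) x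
  refine ⟨{ toFun := F, inj' := ?_, map_fun' := ?_, map_rel' := ?_ }, hF⟩
  · intro x y hxy
    rw [← hst x, ← hst y]
    exact (hsame _ _ _ _).2 hxy
  · intro n f x
    obtain ⟨i, a, rfl⟩ := hstage x
    have : F ∘ d i ∘ a = g i ∘ a := funext fun t => hF i (a t)
    rw [← FirstOrder.Language.Embedding.map_fun, hF, this,
      FirstOrder.Language.Embedding.map_fun]
  · intro n r x
    obtain ⟨i, a, rfl⟩ := hstage x
    have : F ∘ d i ∘ a = g i ∘ a := funext fun t => hF i (a t)
    change FirstOrder.Language.Structure.RelMap r (F ∘ d i ∘ a) ↔ _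
    rw [this, FirstOrder.Language.Embedding.map_rel, FirstOrder.Language.Embedding.map_rel]

end Glue

section KGlue

variable {L : FirstOrder.Language.{u, u}} {K : AEC L} {δ : Ordinal.{u}}
variable {A : Set.Iio δ → Type u} [∀ i, L.Structure (A i)]

/-- The ranges of a chain of embeddings, indexed by all ordinals. -/
noncomputable def rangeSeq {D : Type u} [L.Structure D] (d : ∀ i, A i ↪[L] D) (i : Ordinal.{u}) :
    L.Substructure D :=
  -- The chain axioms look only at indices below `δ`, so the value `⊤` beyond is arbitrary.
  open Classical in if h : i < δ then (d ⟨i, h⟩).toHom.range else ⊤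

theorem rangeSeq_of_lt {D : Type u} [L.Structure D] (d : ∀ i, A i ↪[L] D) {i : Ordinal.{u}}
    (h : i < δ) : rangeSeq d i = (d ⟨i, h⟩).toHom.range := dif_pos h

theorem rangeSeq_chain {D : Type u} [L.Structure D] (d : ∀ i, A i ↪[L] D)
    (hd : ∀ i j, i ≤ j → ∃ h : A i ↪[L] A j, K.IsKEmbedding h ∧ (d j).comp h = d i)
    (i j : Ordinal.{u}) (hij : i < j) (hj : j < δ) :
    rangeSeq d i ≤ rangeSeq d j ∧
      K.Strong ((rangeSeq d i).comap (rangeSeq d j).subtype.toHom) := by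
  obtain ⟨h, hh, e⟩ := hd ⟨i, hij.trans hj⟩ ⟨j, hj⟩ hij.le
  rw [rangeSeq_of_lt d hj, rangeSeq_of_lt d (hij.trans hj), ← e]
  exact ⟨range_comp_le _ _, hh.strong_comap _⟩

theorem iUnion_rangeSeq {D : Type u} [L.Structure D] (d : ∀ i, A i ↪[L] D) (x : D) :
    x ∈ (⋃ i ∈ Set.Iio δ, (rangeSeq d i : Set D)) ↔ ∃ i a, d i a = x := by
  simp only [Set.mem_iUnion, Set.mem_Iio, exists_prop, SetLike.mem_coe]
  constructor
  · rintro ⟨i, hi, hx⟩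
    rw [rangeSeq_of_lt d hi, mem_range_embedding] at hx
    exact ⟨⟨i, hi⟩, hx⟩
  · rintro ⟨⟨i, hi⟩, hx⟩
    refine ⟨i, hi, ?_⟩
    rw [rangeSeq_of_lt d hi, mem_range_embedding]
    exact hx

/-- The union of a chain of `K`-embeddings is a `K`-extension of its members. -/
theorem isKEmbedding_of_chain (hδ : Order.IsSuccLimit δ) {D : Type u} [L.Structure D]
    (d : ∀ i, A i ↪[L] D)
    (hd : ∀ i j, i ≤ j → ∃ h : A i ↪[L] A j, K.IsKEmbedding h ∧ (d j).comp h = d i)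
    (hsurj : ∀ x, ∃ i a, d i a = x) : ∀ i, K.IsKEmbedding (d i) := by
  have h := (K.chain_union δ hδ (rangeSeq d) (rangeSeq_chain d hd)
    (Set.eq_univ_of_forall fun x => (iUnion_rangeSeq d x).2 (hsurj x))).2
  intro i
  obtain ⟨h', hh', -⟩ := hd i i le_rfl
  refine ⟨hh'.1, ?_⟩
  have := h i.1 i.2
  rwa [rangeSeq_of_lt d i.2] at this

/-- Compatible `K`-embeddings of the members of a chain glue to a `K`-embedding of its union. -/
theorem exists_glue_isKEmbedding (hδ : Order.IsSuccLimit δ) {D Y : Type u} [L.Structure D]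
    [L.Structure Y] (d : ∀ i, A i ↪[L] D) (g : ∀ i, A i ↪[L] Y)
    (hg : ∀ i, K.IsKEmbedding (g i))
    (hd : ∀ i j, i ≤ j → ∃ h : A i ↪[L] A j, K.IsKEmbedding h ∧ (∀ a, d j (h a) = d i a) ∧
      ∀ a, g j (h a) = g i a)
    (hsurj : ∀ x, ∃ i a, d i a = x) :
    ∃ f : D ↪[L] Y, K.IsKEmbedding f ∧ ∀ i a, f (d i a) = g i a := by
  have : Nonempty (Set.Iio δ) := ⟨⟨0, hδ.bot_lt⟩⟩
  obtain ⟨f, hf⟩ := exists_glue d g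
    (fun i j hij => (hd i j hij).imp fun h hh => hh.2) hsurj
  refine ⟨f, ⟨?_, ?_⟩, hf⟩
  · refine (isKEmbedding_of_chain (K := K) hδ d (fun i j hij => ?_) hsurj
      (Classical.arbitrary _)).mem_right
    obtain ⟨h, h1, h2, -⟩ := hd i j hij
    exact ⟨h, h1, by ext a; exact h2 a⟩
  · refine K.chain_strong δ hδ (rangeSeq g) _ (rangeSeq_chain g fun i j hij => ?_) ?_ ?_
    · obtain ⟨h, h1, -, h3⟩ := hd i j hij
      exact ⟨h, h1, by ext a; exact h3 a⟩
    · intro i hi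
      rw [rangeSeq_of_lt g hi]
      exact (hg _).2
    · ext y
      rw [iUnion_rangeSeq, SetLike.mem_coe, mem_range_embedding]
      constructor
      · rintro ⟨x, rfl⟩
        obtain ⟨i, a, rfl⟩ := hsurj x
        exact ⟨i, a, (hf i a).symm⟩
      · rintro ⟨i, a, rfl⟩
        exact ⟨d i a, hf i a⟩

end KGlue

end AEC

/-! ### Transfinite chains and enumerations -/

/-- Transfinite recursion in a preorder: a continuous increasing sequence of length `θ + 1`,
for an invariant `Inv` and with successive members related by `R`. -/
theorem exists_transfinite_chain {P X : Type*} [Preorder P] (θ : Ordinal.{u})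
    (Inv : Ordinal.{u} → P → Prop) (R : Ordinal.{u} → P → P → Prop) (c : P → Set X)
    (p₀ : P) (h₀ : Inv 0 p₀)
    (hsucc : ∀ i < θ, ∀ p, Inv i p → ∃ q, p ≤ q ∧ Inv (succ i) q ∧ R i p q)
    (hlim : ∀ δ ≤ θ, IsSuccLimit δ → ∀ S : Ordinal.{u} → P,
      (∀ i j, i ≤ j → j < δ → S i ≤ S j) → (∀ i < δ, Inv i (S i)) →
      ∃ q, (∀ i < δ, S i ≤ q) ∧ Inv δ q ∧ c q = ⋃ i ∈ Iio δ, c (S i)) :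
    ∃ S : Ordinal.{u} → P, Monotone S ∧ S 0 = p₀ ∧ (∀ i ≤ θ, Inv i (S i)) ∧
      (∀ i < θ, R i (S i) (S (succ i))) ∧
      ∀ δ ≤ θ, IsSuccLimit δ → c (S δ) = ⋃ i ∈ Iio δ, c (S i) := by
  classical
  -- The successor and limit choices are made total, so that the recursion can be run first and the
  -- invariant proved afterwards.
  have hs : ∀ i p, ∃ q, i < θ → Inv i p → p ≤ q ∧ Inv (succ i) q ∧ R i p q := by
    intro i p
    by_cases h : i < θ ∧ Inv i p
    · exact (hsucc i h.1 p h.2).imp fun q hq _ _ => hq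
    · exact ⟨p, fun h1 h2 => (h ⟨h1, h2⟩).elim⟩
  choose nxt hnxt using hs
  have hl : ∀ (δ : Ordinal.{u}) (S : Ordinal.{u} → P), ∃ q, δ ≤ θ → IsSuccLimit δ →
      (∀ i j, i ≤ j → j < δ → S i ≤ S j) → (∀ i < δ, Inv i (S i)) →
      (∀ i < δ, S i ≤ q) ∧ Inv δ q ∧ c q = ⋃ i ∈ Iio δ, c (S i) := by
    intro δ S
    by_cases h : (δ ≤ θ ∧ IsSuccLimit δ) ∧
      (∀ i j, i ≤ j → j < δ → S i ≤ S j) ∧ (∀ i < δ, Inv i (S i))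
    · exact (hlim δ h.1.1 h.1.2 S h.2.1 h.2.2).imp fun q hq _ _ _ _ => hq
    · exact ⟨p₀, fun h1 h2 h3 h4 => (h ⟨⟨h1, h2⟩, h3, h4⟩).elim⟩
  choose lim hlim' using hl
  let F : Ordinal.{u} → P := fun o => Ordinal.limitRecOn (motive := fun _ => P) o p₀
    (fun i p => nxt i p) (fun δ _ f => lim δ fun j => if h : j < δ then f j h else p₀)
  have F0 : F 0 = p₀ := Ordinal.limitRecOn_zero _ _ _
  have Fs : ∀ i, F (succ i) = nxt i (F i) := fun i => by
    rw [Order.succ_eq_add_one]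
    exact Ordinal.limitRecOn_add_one _ _ _ _
  have Fl : ∀ δ, IsSuccLimit δ → F δ = lim δ fun j => if j < δ then F j else p₀ :=
    fun δ hδ => (Ordinal.limitRecOn_limit _ _ _ _ hδ).trans (by simp [F])
  have key : ∀ i ≤ θ, Inv i (F i) ∧ (∀ j ≤ i, F j ≤ F i) ∧
      (IsSuccLimit i → c (F i) = ⋃ j ∈ Iio i, c (F j)) := by
    intro i
    induction i using Ordinal.limitRecOn with
    | zero =>
      intro _
      refine ⟨F0.symm ▸ h₀, fun j hj => ?_, fun h => (h.1 isMin_bot).elim⟩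
      rw [le_bot_iff.1 hj]
      exact le_rfl
    | add_one i ih =>
      rw [← Order.succ_eq_add_one]
      intro hi
      have hi' : i < θ := (Order.lt_succ i).trans_le hi
      obtain ⟨h1, h2, -⟩ := ih hi'.le
      obtain ⟨g1, g2, -⟩ := hnxt i (F i) hi' h1
      rw [← Fs] at g1 g2
      refine ⟨g2, fun j hj => ?_, fun h => (Order.not_isSuccLimit_succ i h).elim⟩
      rcases hj.lt_or_eq with hj | rfl
      · exact (h2 j (Order.lt_succ_iff.1 hj)).trans g1
      · exact le_rfl
    | limit δ hδ ih =>
      intro hδθ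
      have e : ∀ i < δ, (if i < δ then F i else p₀) = F i := fun i hi => if_pos hi
      obtain ⟨g1, g2, g3⟩ := hlim' δ (fun j => if j < δ then F j else p₀) hδθ hδ
        (fun i j hij hj => by
          rw [e i (hij.trans_lt hj), e j hj]
          exact (ih j hj (hj.le.trans hδθ)).2.1 i hij)
        (fun i hi => by
          rw [e i hi]
          exact (ih i hi (hi.le.trans hδθ)).1)
      rw [← Fl δ hδ] at g1 g2 g3
      refine ⟨g2, fun j hj => ?_, fun _ => g3.trans ?_⟩
      · rcases hj.lt_or_eq with hj | rfl
        · have := g1 j hj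
          rwa [e j hj] at this
        · exact le_rfl
      · exact iUnion₂_congr fun i hi => by rw [e i hi]
  -- Freezing the sequence after `θ` makes it monotone on all ordinals.
  refine ⟨fun i => F (min i θ), fun i j hij => ?_, ?_, fun i hi => ?_, fun i hi => ?_,
    fun δ hδ hl => ?_⟩
  · exact (key _ (min_le_right _ _)).2.1 _ (min_le_min_right _ hij)
  · simpa using F0
  · simpa [min_eq_left hi] using (key i hi).1
  · simp only [min_eq_left hi.le, min_eq_left (Order.succ_le_of_lt hi), Fs]
    exact (hnxt i (F i) hi (key i hi.le).1).2.2
  · simp only [min_eq_left hδ]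
    rw [(key δ hδ).2.2 hl]
    exact iUnion₂_congr fun i hi => by rw [min_eq_left ((mem_Iio.1 hi).le.trans hδ)]

theorem mk_biUnion_Iio_le {α : Type u} {δ : Ordinal.{u}} {ν : Cardinal.{u}} (hν : ℵ₀ ≤ ν)
    (hδ : δ.card ≤ ν) (X : Ordinal.{u} → Set α) (hX : ∀ i < δ, #(X i) ≤ ν) :
    #(⋃ i ∈ Iio δ, X i : Set α) ≤ ν := by
  rw [← Cardinal.lift_le.{u + 1}]
  have h1 : Cardinal.lift.{u} #(Iio δ) ≤ Cardinal.lift.{u + 1} ν := by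
    rw [Cardinal.mk_Iio_ordinal, Cardinal.lift_id'.{u, u + 1}]
    exact Cardinal.lift_le.2 hδ
  have h2 : ⨆ i : Iio δ, Cardinal.lift.{u + 1} #(X i) ≤ Cardinal.lift.{u + 1} ν :=
    ciSup_le' fun i => Cardinal.lift_le.2 (hX i.1 i.2)
  have h3 : Cardinal.lift.{u + 1} ν * Cardinal.lift.{u + 1} ν = Cardinal.lift.{u + 1} ν :=
    Cardinal.mul_eq_self (Cardinal.aleph0_le_lift.2 hν)
  exact (Cardinal.mk_biUnion_le_lift X (Iio δ)).trans ((mul_le_mul' h1 h2).trans h3.le)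

/-- A nonempty type of cardinality at most `κ` can be listed in order type `κ`. -/
theorem exists_enumeration {T : Type (u + 1)} [Nonempty T] {κ : Cardinal.{u}}
    (hT : #T ≤ Cardinal.lift.{u + 1} κ) :
    ∃ a : Ordinal.{u} → T, ∀ t, ∃ i < κ.ord, a i = t := by
  classical
  have h : #T ≤ #(Iio κ.ord) := by
    rwa [Cardinal.mk_Iio_ordinal, Cardinal.card_ord]
  obtain ⟨f⟩ := h
  refine ⟨fun i => if h : ∃ t, (f t : Ordinal) = i then h.choose else Classical.arbitrary T,
    fun t => ⟨f t, (f t).2, ?_⟩⟩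
  have h : ∃ t', (f t' : Ordinal) = f t := ⟨t, rfl⟩
  simp only [dif_pos h]
  exact f.injective (Subtype.ext h.choose_spec)

theorem exists_enumeration_small {T : Type u} [Nonempty T] {κ : Cardinal.{u}} (hT : #T ≤ κ) :
    ∃ a : Ordinal.{u} → T, ∀ t, ∃ i < κ.ord, a i = t := by
  obtain ⟨a, ha⟩ := exists_enumeration (T := ULift.{u + 1} T) (κ := κ) (by
    rw [Cardinal.mk_uLift]
    exact Cardinal.lift_le.2 hT)
  exact ⟨fun i => (a i).down, fun t => (ha ⟨t⟩).imp fun i h => ⟨h.1, congrArg ULift.down h.2⟩⟩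

theorem Ordinal.card_le_of_le_ord {δ : Ordinal.{u}} {κ : Cardinal.{u}} (h : δ ≤ κ.ord) :
    δ.card ≤ κ := by
  simpa using Ordinal.card_le_card h

/-! ### Models on subsets of a fixed large set, where chains grow by inclusion -/

namespace AEC

variable {L : FirstOrder.Language.{u, u}}

/-- A model in `K` whose universe is a subset of `U`. -/
structure ModelIn (K : AEC L) (U : Type u) where
  /-- the universe of the model -/
  carrier : Set U
  /-- the structure on the universe -/
  str : L.Structure carrier
  mem : K.Mem carrier

namespace ModelIn

variable {K : AEC L} {U : Type u}

attribute [instance] ModelIn.str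

/-- `A ≤ B` if `A` is a strong substructure of `B`. -/
instance : LE (ModelIn K U) where
  le A B := ∃ e : A.carrier ↪[L] B.carrier, (∀ x, (e x : U) = x) ∧ K.IsKEmbedding e

/-- The inclusion of a strong substructure. -/
noncomputable def incl {A B : ModelIn K U} (h : A ≤ B) : A.carrier ↪[L] B.carrier := h.choose

@[simp]
theorem incl_coe {A B : ModelIn K U} (h : A ≤ B) (x : A.carrier) : (incl h x : U) = x :=
  h.choose_spec.1 x

theorem isK_incl {A B : ModelIn K U} (h : A ≤ B) : K.IsKEmbedding (incl h) := h.choose_spec.2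

instance : Preorder (ModelIn K U) where
  le_refl A := ⟨.refl L _, fun _ => rfl, isKEmbedding_refl A.mem⟩
  le_trans A B C h h' := ⟨(incl h').comp (incl h), fun x => by simp,
    (isK_incl h').comp (isK_incl h)⟩

theorem incl_comp_incl {A B C : ModelIn K U} (h : A ≤ B) (h' : B ≤ C) :
    (incl h').comp (incl h) = incl (h.trans h') := by
  ext x
  simp

theorem carrier_subset {A B : ModelIn K U} (h : A ≤ B) : A.carrier ⊆ B.carrier := fun x hx => by
  have := (incl h ⟨x, hx⟩).2
  rwa [incl_coe] at this

/-- A bijection of a model with a subset of `U` makes that subset a model. -/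
theorem exists_of_injective {N : Type u} [L.Structure N] (hN : K.Mem N) (φ : N → U)
    (hφ : Function.Injective φ) :
    ∃ (B : ModelIn K U) (g : N ≃[L] B.carrier), ∀ n, (g n : U) = φ n := by
  let e : N ≃ range φ := Equiv.ofInjective φ hφ
  let _ : L.Structure (range φ) := e.inducedStructure
  let g : N ≃[L] range φ := e.inducedStructureEquiv
  exact ⟨⟨range φ, inferInstance, K.mem_iso g hN⟩, g, fun n => rfl⟩

theorem exists_copy {N : Type u} [L.Structure N] (hN : K.Mem N) (hc : #N ≤ #U) :
    ∃ (B : ModelIn K U), Nonempty (N ≃[L] B.carrier) := by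
  obtain ⟨φ⟩ := hc
  obtain ⟨B, g, -⟩ := exists_of_injective hN φ φ.injective
  exact ⟨B, ⟨g⟩⟩

/-- Every small extension of a model in `U` can be realized in `U`. -/
theorem exists_extension {κ : Cardinal.{u}} (hκ : ℵ₀ ≤ κ) (hU : κ < #U) (A : ModelIn K U)
    (hA : #A.carrier ≤ κ) {N : Type u} [L.Structure N] {e : A.carrier ↪[L] N}
    (he : K.IsKEmbedding e) (hN : #N ≤ κ) :
    ∃ (B : ModelIn K U) (h : A ≤ B) (g : N ≃[L] B.carrier),
      g.toEmbedding.comp e = incl h := by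
  classical
  have : Infinite U := Cardinal.infinite_iff.2 (hκ.trans hU.le)
  have hcompl : #N ≤ #(A.carrierᶜ : Set U) := by
    rw [Cardinal.mk_compl_of_infinite _ (hA.trans_lt hU)]
    exact hN.trans hU.le
  obtain ⟨ψ⟩ := hcompl
  -- Points of `e[A]` return to their original place, and the others go injectively into the
  -- complement of `A`, which has full size because `#A ≤ κ < #U`.
  let φ : N → U := fun n => if h : ∃ a, e a = n then (h.choose : U) else ψ n
  have h1 : ∀ a, φ (e a) = a := fun a => by
    have h : ∃ a', e a' = e a := ⟨a, rfl⟩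
    simp only [φ, dif_pos h]
    exact congrArg Subtype.val (e.injective h.choose_spec)
  have h2 : ∀ n, (¬ ∃ a, e a = n) → φ n = ψ n := fun n h => dif_neg h
  have hφ : Function.Injective φ := by
    intro m n hmn
    by_cases hm : ∃ a, e a = m <;> by_cases hn : ∃ a, e a = n
    · obtain ⟨a, rfl⟩ := hm
      obtain ⟨b, rfl⟩ := hn
      rw [h1, h1] at hmn
      rw [Subtype.ext hmn]
    · obtain ⟨a, rfl⟩ := hm
      rw [h1, h2 n hn] at hmn
      exact ((ψ n).2 (hmn ▸ a.2)).elim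
    · obtain ⟨b, rfl⟩ := hn
      rw [h1, h2 m hm] at hmn
      exact ((ψ m).2 (hmn ▸ b.2)).elim
    · rw [h2 m hm, h2 n hn] at hmn
      exact ψ.injective (Subtype.ext hmn)
  obtain ⟨B, g, hg⟩ := exists_of_injective he.mem_right φ hφ
  have hAB : A ≤ B := ⟨g.toEmbedding.comp e, fun x => (hg _).trans (h1 x),
    (isKEmbedding_equiv g he.mem_right).comp he⟩
  refine ⟨B, hAB, g, ?_⟩
  ext x
  rw [incl_coe]
  exact (hg _).trans (h1 x)

/-- Unions of chains of models. -/
theorem exists_union {δ : Ordinal.{u}} (hδ : IsSuccLimit δ) (S : Ordinal.{u} → ModelIn K U)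
    (hS : ∀ i j, i ≤ j → j < δ → S i ≤ S j) :
    ∃ T : ModelIn K U, (∀ i < δ, S i ≤ T) ∧ T.carrier = ⋃ i ∈ Iio δ, (S i).carrier := by
  have : Nonempty (Iio δ) := ⟨⟨0, hδ.bot_lt⟩⟩
  let D : Set U := ⋃ i ∈ Iio δ, (S i).carrier
  let d : ∀ i : Iio δ, (S i).carrier → D := fun i x => ⟨x, mem_iUnion₂.2 ⟨i.1, i.2, x.2⟩⟩
  have hsurj : ∀ x, ∃ i a, d i a = x := by
    rintro ⟨x, hx⟩
    obtain ⟨i, hi, hxi⟩ := mem_iUnion₂.1 hx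
    exact ⟨⟨i, hi⟩, ⟨x, hxi⟩, rfl⟩
  obtain ⟨str, he⟩ := exists_union_structure (L := L) d
    (fun i x y h => Subtype.ext (congrArg (fun z : D => (z : U)) h))
    (fun i j hij => ⟨incl (hS i j hij j.2), fun a => Subtype.ext (incl_coe _ _)⟩) hsurj
  choose e he using he
  have hK : ∀ i, K.IsKEmbedding (e i) := by
    refine isKEmbedding_of_chain hδ e (fun i j hij => ⟨incl (hS i j hij j.2), isK_incl _, ?_⟩)
      fun x => ?_
    · ext a
      rw [FirstOrder.Language.Embedding.comp_apply, he, he]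
      exact incl_coe _ _
    · obtain ⟨i, a, h⟩ := hsurj x
      exact ⟨i, a, (he i a).trans h⟩
  exact ⟨⟨D, str, (hK (Classical.arbitrary _)).mem_right⟩,
    fun i hi => ⟨e ⟨i, hi⟩, fun x => congrArg (fun z : D => (z : U)) (he ⟨i, hi⟩ x), hK _⟩, rfl⟩

end ModelIn

end AEC

/-! ### Universal extensions from stability -/

namespace AEC

variable {L : FirstOrder.Language.{u, u}} {K : AEC L}

theorem galoisType_eq {M A B : Type u} [L.Structure M] [L.Structure A] [L.Structure B]
    {f : M ↪[L] A} (hf : K.IsKEmbedding f) {f' : M ↪[L] B} (hf' : K.IsKEmbedding f')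
    {g : A ↪[L] B} (hg : K.IsKEmbedding g) (hgf : g.comp f = f') {a : A} {b : B} (hab : g a = b) :
    (Quot.mk _ ⟨A, f, hf, a⟩ : K.GaloisTypes M) = Quot.mk _ ⟨B, f', hf', b⟩ := by
  subst hgf hab
  exact galoisType_comp hf hg a

/-- `B` realizes all Galois types over `A`, embedded in `B` by `e`. -/
def RealizesAll {A B : Type u} [L.Structure A] [L.Structure B] (e : A ↪[L] B) : Prop :=
  ∃ he : K.IsKEmbedding e, ∀ q : K.GaloisTypes A, ∃ b : B, Quot.mk _ ⟨B, e, he, b⟩ = q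

section Stable

variable {κ : Cardinal.{u}} {U : Type u}

namespace ModelIn

theorem card_union {δ : Ordinal.{u}} (hκ : ℵ₀ ≤ κ) (hδ : δ ≤ κ.ord) {T : ModelIn K U}
    {S : Ordinal.{u} → ModelIn K U} (hT : T.carrier = ⋃ i ∈ Iio δ, (S i).carrier)
    (hS : ∀ i < δ, #(S i).carrier ≤ κ) : #T.carrier ≤ κ := by
  rw [hT]
  exact mk_biUnion_Iio_le hκ (Ordinal.card_le_of_le_ord hδ) _ hS

/-- A realization of `q` is amalgamated with `B` over `A`; the amalgam is cut down to size `κ`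
around `B` and the realizing point, then copied into `U` over `B`. -/
theorem exists_extension_realizing (hAP : K.AmalgamationProperty) (hκ : K.LS ≤ κ) (hU : κ < #U)
    {A : Type u} [L.Structure A] (B : ModelIn K U) (hB : #B.carrier ≤ κ) {e : A ↪[L] B.carrier}
    (he : K.IsKEmbedding e) (q : K.GaloisTypes A) :
    ∃ (B' : ModelIn K U) (h : B ≤ B'), #B'.carrier ≤ κ ∧
      ∃ b, (Quot.mk _ ⟨B'.carrier, (incl h).comp e, (isK_incl h).comp he, b⟩ :
        K.GaloisTypes A) = q := by
  have hκ0 := (LS_spec K).1.trans hκ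
  obtain ⟨p, rfl⟩ := Quot.exists_rep q
  obtain ⟨W', _, i, j, hi, hj, hij⟩ := hAP A p.N B.carrier p.emb e p.isK he
  obtain ⟨W, _, k, hk, hW, hX⟩ := exists_small_model hκ hj.mem_right (range j ∪ {i p.pt})
    ((Cardinal.mk_union_le _ _).trans (Cardinal.add_le_of_le hκ0
      (Cardinal.mk_range_le.trans hB) ((Cardinal.mk_singleton _).le.trans
        (Cardinal.one_le_aleph0.trans hκ0))))
  obtain ⟨j', hj', rfl⟩ := hk.exists_factor hj fun b => hX _ (Or.inl ⟨b, rfl⟩)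
  obtain ⟨w, hw⟩ := hX _ (Or.inr rfl)
  obtain ⟨B', h, g, hg⟩ := exists_extension hκ0 hU B hB hj' hW
  refine ⟨B', h, (card_le_of_embedding g.symm.toEmbedding).trans hW, g w, ?_⟩
  have e1 : (Quot.mk _ p : K.GaloisTypes A) = Quot.mk _ ⟨W', i.comp p.emb, hi.comp p.isK, i p.pt⟩ :=
    galoisType_comp p.isK hi p.pt
  rw [e1, ← galoisType_eq (hj'.comp he) (hi.comp p.isK) hk hij.symm hw]
  refine (galoisType_eq (hj'.comp he) _ (isKEmbedding_equiv g hj'.mem_right) ?_ rfl).symm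
  rw [← hg]
  rfl

end ModelIn

open ModelIn

/-- In a stable cardinal, all types over a model are realized in a single extension. -/
theorem exists_realizesAll (hAP : K.AmalgamationProperty) (hκ : K.LS ≤ κ) (hstab : K.GaloisStable κ)
    {A : Type u} [L.Structure A] (hA : K.Mem A) (hc : #A = κ) :
    ∃ (B : Type u) (_ : L.Structure B) (e : A ↪[L] B), RealizesAll (K := K) e ∧ #B ≤ κ := by
  have hκ0 := (LS_spec K).1.trans hκ
  have hU : κ < #(succ κ).out := by
    rw [Cardinal.mk_out]
    exact Order.lt_succ κ
  have hne : Nonempty A := Cardinal.mk_ne_zero_iff.1 (by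
    rw [hc]
    exact (Cardinal.aleph0_pos.trans_le hκ0).ne')
  have hne' : Nonempty (K.GaloisTypes A) :=
    ⟨Quot.mk _ ⟨A, .refl L A, isKEmbedding_refl hA, Classical.arbitrary A⟩⟩
  -- Stability lists all types over `A` in order type `κ`; step `i` of the chain realizes `t i`, and
  -- later models keep the realization.
  obtain ⟨t, ht⟩ := exists_enumeration (hstab A hA hc)
  obtain ⟨A₀, ⟨g₀⟩⟩ := exists_copy (U := (succ κ).out) hA (hc.le.trans hU.le)
  have hg₀ := isKEmbedding_equiv g₀ hA
  have hcA : #A₀.carrier ≤ κ := (card_le_of_embedding g₀.symm.toEmbedding).trans hc.le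
  obtain ⟨S, hmono, -, hInv, hR, -⟩ := exists_transfinite_chain κ.ord
    (fun _ (B : ModelIn K (succ κ).out) => A₀ ≤ B ∧ #B.carrier ≤ κ)
    (fun i _ B => ∃ (h : A₀ ≤ B) (b : B.carrier),
      Quot.mk _ ⟨B.carrier, (incl h).comp g₀.toEmbedding, (isK_incl h).comp hg₀, b⟩ = t i)
    (fun B => B.carrier) A₀ ⟨le_rfl, hcA⟩
    (by
      rintro i hi B ⟨hB, hBc⟩
      obtain ⟨B', h, hc', b, hb⟩ := exists_extension_realizing hAP hκ hU B hBc
        ((isK_incl hB).comp hg₀) (t i)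
      refine ⟨B', h, ⟨hB.trans h, hc'⟩, hB.trans h, b, ?_⟩
      rw [← hb]
      congr 2
      rw [← incl_comp_incl hB h]
      rfl)
    (by
      intro δ hδ hl S hS hInv
      obtain ⟨T, hT, hTc⟩ := exists_union hl S hS
      exact ⟨T, hT, ⟨(hInv 0 hl.bot_lt).1.trans (hT 0 hl.bot_lt),
        card_union hκ0 hδ hTc fun i hi => (hInv i hi).2⟩, hTc⟩)
  have hB := hInv κ.ord le_rfl
  refine ⟨(S κ.ord).carrier, inferInstance, (incl hB.1).comp g₀.toEmbedding,
    ⟨(isK_incl _).comp hg₀, fun q => ?_⟩, hB.2⟩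
  obtain ⟨i, hi, rfl⟩ := ht q
  obtain ⟨h, b, hb⟩ := hR i hi
  have hle : S (succ i) ≤ S κ.ord := hmono (Order.succ_le_of_lt hi)
  refine ⟨incl hle b, ?_⟩
  rw [← hb]
  refine (galoisType_eq _ _ (isK_incl hle) ?_ rfl).symm
  rw [← incl_comp_incl h hle]
  rfl

/-- A continuous chain of models of size `κ`, each realizing all types over its predecessor. -/
theorem exists_type_chain (hAP : K.AmalgamationProperty) (hκ : K.LS ≤ κ)
    (hstab : K.GaloisStable κ) (hU : κ < #U) (A : ModelIn K U) (hA : #A.carrier = κ) :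
    ∃ S : Ordinal.{u} → ModelIn K U, Monotone S ∧ S 0 = A ∧ (∀ i ≤ κ.ord, #(S i).carrier = κ) ∧
      (∀ i < κ.ord, ∃ h : S i ≤ S (succ i), RealizesAll (K := K) (incl h)) ∧
      ∀ δ ≤ κ.ord, IsSuccLimit δ → (S δ).carrier = ⋃ i ∈ Iio δ, (S i).carrier := by
  have hκ0 := (LS_spec K).1.trans hκ
  refine exists_transfinite_chain κ.ord (fun _ (B : ModelIn K U) => #B.carrier = κ)
    (fun _ p q => ∃ h : p ≤ q, RealizesAll (K := K) (incl h)) (fun B => B.carrier) A hA ?_ ?_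
  · intro i hi p hp
    obtain ⟨B, _, e, ⟨he, hall⟩, hB⟩ := exists_realizesAll hAP hκ hstab p.mem hp
    obtain ⟨q, h, g, hg⟩ := exists_extension hκ0 hU p hp.le he hB
    refine ⟨q, h, ((card_le_of_embedding g.symm.toEmbedding).trans hB).antisymm
      (hp.symm.le.trans (card_le_of_embedding (incl h))), h, isK_incl h, fun t => ?_⟩
    obtain ⟨b, rfl⟩ := hall t
    exact ⟨g b, (galoisType_eq _ _ (isKEmbedding_equiv g he.mem_right) hg rfl).symm⟩
  · intro δ hδ hl S hS hInv
    obtain ⟨T, hT, hTc⟩ := exists_union hl S hS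
    exact ⟨T, hT, (card_union hκ0 hδ hTc fun i hi => (hInv i hi).le).antisymm
      ((hInv 0 hl.bot_lt).symm.le.trans (card_le_of_embedding (incl (hT 0 hl.bot_lt)))), hTc⟩

/-- A `K`-embedding between models in `U`. -/
structure MapIn (K : AEC L) (U : Type u) where
  /-- the source -/
  A : ModelIn K U
  /-- the target -/
  B : ModelIn K U
  /-- the embedding -/
  f : A.carrier ↪[L] B.carrier
  isK : K.IsKEmbedding f

instance : Preorder (MapIn K U) where
  le p q := p.A ≤ q.A ∧ p.B ≤ q.B ∧
    ∀ (x : p.A.carrier) (y : q.A.carrier), (x : U) = y → (p.f x : U) = q.f y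
  le_refl p := ⟨le_rfl, le_rfl, fun x y h => by rw [Subtype.ext h]⟩
  le_trans p q r h h' := ⟨h.1.trans h'.1, h.2.1.trans h'.2.1, fun x y hxy => by
    rw [h.2.2 x ⟨x, carrier_subset h.1 x.2⟩ rfl]
    exact h'.2.2 _ _ hxy⟩

/-- One step of the construction of an embedding onto a prescribed set. -/
theorem exists_mapIn_step (hκ : K.LS ≤ κ) (hU : κ < #U) (hAP : K.AmalgamationProperty)
    (p : MapIn K U) {M : ModelIn K U}
    (hM : p.A ≤ M) (hreal : RealizesAll (K := K) (incl hM)) (hMc : #M.carrier ≤ κ)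
    (hBc : #p.B.carrier ≤ κ) (x : p.B.carrier) :
    ∃ q : MapIn K U, p ≤ q ∧ q.A = M ∧ #q.B.carrier ≤ κ ∧ ∃ b, (q.f b : U) = x := by
  have hκ0 := (LS_spec K).1.trans hκ
  obtain ⟨he, hall⟩ := hreal
  -- Through `p.f`, the point `x` has a Galois type over `p.A`, realized in `M` by some `b`.
  -- Equality of types yields an amalgam identifying `b` with `x`, so `p.f` extends to `M` with `b`
  -- sent to `x`.
  obtain ⟨b, hb⟩ := hall (Quot.mk _ ⟨p.B.carrier, p.f, p.isK, x⟩)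
  obtain ⟨W', _, j, i, hj, hi, hij, hpt⟩ := galoisRel_of_mk_eq hAP hb
  change j.comp (incl hM) = i.comp p.f at hij
  change j b = i x at hpt
  obtain ⟨W, _, k, hk, hW, hX⟩ := exists_small_model hκ hj.mem_right (range j ∪ range i)
    ((Cardinal.mk_union_le _ _).trans (Cardinal.add_le_of_le hκ0
      (Cardinal.mk_range_le.trans hMc) (Cardinal.mk_range_le.trans hBc)))
  obtain ⟨j', hj', rfl⟩ := hk.exists_factor hj fun b => hX _ (Or.inl ⟨b, rfl⟩)
  obtain ⟨i', hi', rfl⟩ := hk.exists_factor hi fun b => hX _ (Or.inr ⟨b, rfl⟩)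
  obtain ⟨B', h, g, hg⟩ := exists_extension hκ0 hU p.B hBc hi' hW
  have hg' : ∀ y, (g (i' y) : U) = y := fun y => by
    have := DFunLike.congr_fun hg y
    rw [← incl_coe h y, ← this]
    rfl
  refine ⟨⟨M, B', g.toEmbedding.comp j', (isKEmbedding_equiv g hj'.mem_right).comp hj'⟩,
    ⟨hM, h, fun y z hyz => ?_⟩, rfl, (card_le_of_embedding g.symm.toEmbedding).trans hW, b, ?_⟩
  · have hz : z = incl hM y := Subtype.ext (by rw [incl_coe, hyz])
    subst hz
    have h1 : j' (incl hM y) = i' (p.f y) := k.injective (DFunLike.congr_fun hij y)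
    change _ = (g (j' (incl hM y)) : U)
    rw [h1, hg']
  · have h1 : j' b = i' x := k.injective hpt
    change (g (j' b) : U) = x
    rw [h1, hg']

/-- The union of a chain as in `exists_type_chain` is universal over its first member. -/
theorem universal_of_type_chain (hκ : K.LS ≤ κ) (hU : κ < #U) (hAP : K.AmalgamationProperty)
    {S : Ordinal.{u} → ModelIn K U} (hmono : Monotone S) (hc : ∀ i ≤ κ.ord, #(S i).carrier = κ)
    (hreal : ∀ i < κ.ord, ∃ h : S i ≤ S (succ i), RealizesAll (K := K) (incl h))
    (hcont : ∀ δ ≤ κ.ord, IsSuccLimit δ → (S δ).carrier = ⋃ i ∈ Iio δ, (S i).carrier)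
    (h0 : S 0 ≤ S κ.ord) : K.IsUniversalExt (incl h0) := by
  have hκ0 := (LS_spec K).1.trans hκ
  refine ⟨isK_incl _, (hc 0 zero_le).trans (hc _ le_rfl).symm, fun N' _ h hh hN' => ?_⟩
  have hN : #N' = κ := hN'.trans (hc 0 zero_le)
  obtain ⟨B₀, ⟨g₀⟩⟩ := exists_copy (U := U) hh.mem_right (hN.le.trans hU.le)
  have hg₀ := isKEmbedding_equiv g₀ hh.mem_right
  have hB₀ : #B₀.carrier ≤ κ := (card_le_of_embedding g₀.symm.toEmbedding).trans hN.le
  have hne : Nonempty B₀.carrier := by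
    have : Nonempty N' := Cardinal.mk_ne_zero_iff.1 (by
      rw [hN]
      exact (Cardinal.aleph0_pos.trans_le hκ0).ne')
    exact this.map g₀
  obtain ⟨a, ha⟩ := exists_enumeration_small hB₀
  -- The maps `S i → B_i` grow, with `B₀` a copy of `N'`, and step `i` puts `a i` into the range.
  -- Only `B₀` has to be covered, so no bookkeeping for the growing targets is needed. The
  -- set-valued argument is `∅` since continuity is already contained in the invariant on sources.
  obtain ⟨p, hp, hp0, hInv, hR, -⟩ := exists_transfinite_chain (X := U) κ.ord
    (fun i (p : MapIn K U) => p.A = S i ∧ B₀ ≤ p.B ∧ #p.B.carrier ≤ κ)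
    (fun i _ q => ∃ b, (q.f b : U) = a i) (fun _ => ∅)
    ⟨S 0, B₀, g₀.toEmbedding.comp h, hg₀.comp hh⟩ ⟨rfl, le_rfl, hB₀⟩
    (by
      rintro i hi ⟨A, B, f, hf⟩ ⟨rfl, hB, hBc⟩
      obtain ⟨hle, hr⟩ := hreal i hi
      obtain ⟨q, hq, hqA, hqB, b, hb⟩ := exists_mapIn_step hκ hU hAP ⟨S i, B, f, hf⟩ hle hr
        (hc _ (Order.succ_le_of_lt hi)).le hBc (incl hB (a i))
      exact ⟨q, hq, ⟨hqA, hB.trans hq.2.1, hqB⟩, b, hb.trans (incl_coe _ _)⟩)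
    (by
      intro δ hδ hl p hp hInv
      obtain ⟨T, hT, hTc⟩ := exists_union hl (fun i => (p i).B) fun i j hij hj => (hp i j hij hj).2.1
      have hA : ∀ i : Iio δ, (p i).A ≤ S δ := fun i => by
        rw [(hInv i i.2).1]
        exact hmono (mem_Iio.1 i.2).le
      -- By continuity of `S`, the model `S δ` is the union of the earlier sources.
      obtain ⟨f, hf, hfc⟩ := exists_glue_isKEmbedding hl (fun i : Iio δ => incl (hA i))
        (fun i : Iio δ => (incl (hT i i.2)).comp (p i).f)
        (fun i => (isK_incl _).comp (p i).isK)
        (fun i j hij => ⟨incl (hp i j hij j.2).1, isK_incl _,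
          fun a => Subtype.ext (by simp), fun a => Subtype.ext (by
            rw [FirstOrder.Language.Embedding.comp_apply, FirstOrder.Language.Embedding.comp_apply,
              incl_coe, incl_coe]
            exact ((hp i j hij j.2).2.2 _ _ (incl_coe _ _).symm).symm)⟩)
        (by
          rintro ⟨x, hx⟩
          have hx' := hx
          rw [hcont δ hδ hl] at hx'
          obtain ⟨i, hi, hxi⟩ := mem_iUnion₂.1 hx'
          rw [← (hInv i hi).1] at hxi
          exact ⟨⟨i, hi⟩, ⟨x, hxi⟩, Subtype.ext (incl_coe _ _)⟩)
      refine ⟨⟨S δ, T, f, hf⟩, fun i hi => ⟨hA ⟨i, hi⟩, hT i hi, fun x y hxy => ?_⟩,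
        ⟨rfl, (hInv 0 hl.bot_lt).2.1.trans (hT 0 hl.bot_lt),
          card_union hκ0 hδ hTc fun i hi => (hInv i hi).2.2⟩, by simp⟩
      have hy : y = incl (hA ⟨i, hi⟩) x := Subtype.ext (by rw [incl_coe, hxy])
      change _ = (f y : U)
      rw [hy, hfc ⟨i, hi⟩ x]
      exact (incl_coe _ _).symm)
  have hfin := hInv κ.ord le_rfl
  have hle : p 0 ≤ p κ.ord := hp zero_le
  have hcov : ∀ x : B₀.carrier, ∃ b, ((p κ.ord).f b : U) = x := by
    intro x
    obtain ⟨i, hi, rfl⟩ := ha x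
    obtain ⟨b, hb⟩ := hR i hi
    have hle' : p (succ i) ≤ p κ.ord := hp (Order.succ_le_of_lt hi)
    exact ⟨incl hle'.1 b, (hle'.2.2 b _ (incl_coe _ _).symm).symm.trans hb⟩
  rw [hp0] at hle
  generalize p κ.ord = r at hfin hle hcov
  obtain ⟨A, B, f, hf⟩ := r
  obtain ⟨rfl, hB, -⟩ := hfin
  -- The range of the final map `f` contains `B₀`, so its inverse carries `N'` back into `S κ.ord`;
  -- coherence makes this a `K`-embedding.
  obtain ⟨g, hg, hgf⟩ := hf.exists_factor ((isK_incl hB).comp hg₀) fun n => by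
    obtain ⟨b, hb⟩ := hcov (g₀ n)
    exact ⟨b, Subtype.ext (hb.trans (incl_coe hB (g₀ n)).symm)⟩
  refine ⟨g, hg, ?_⟩
  ext m
  congr 1
  apply f.injective
  have h1 := DFunLike.congr_fun hgf (h m)
  refine h1.trans (Subtype.ext ?_)
  exact (incl_coe hB _).trans (hle.2.2 m (incl h0 m) (incl_coe _ _).symm)

/-- Universal extensions exist in a stable cardinal. -/
theorem exists_universalExt (hAP : K.AmalgamationProperty) (hκ : K.LS ≤ κ)
    (hstab : K.GaloisStable κ) (hU : κ < #U) (A : ModelIn K U) (hA : #A.carrier = κ) :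
    ∃ (B : ModelIn K U) (h : A ≤ B), K.IsUniversalExt (incl h) := by
  obtain ⟨S, hmono, rfl, hc, hreal, hcont⟩ := exists_type_chain hAP hκ hstab hU A hA
  exact ⟨S κ.ord, hmono zero_le,
    universal_of_type_chain hκ hU hAP hmono hc hreal hcont _⟩

/-- If there are no maximal models then universal extensions are proper. -/
theorem IsUniversalExt.not_surjective (hκ : K.LS ≤ κ) (hmax : K.NoMaximalModel κ)
    {A B : Type u} [L.Structure A] [L.Structure B] {f : A ↪[L] B} (hf : K.IsUniversalExt f)
    (hA : #A = κ) : ¬ Function.Surjective f := by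
  intro hs
  have hκ0 := (LS_spec K).1.trans hκ
  obtain ⟨N, _, e, he, hne⟩ := hmax A hf.1.mem_left hA
  simp only [Function.Surjective, not_forall] at hne
  obtain ⟨n, hn⟩ := hne
  -- The proper extension may be too large, so it is cut down to size `κ` around the base and one
  -- new point. Universality embeds it over `A`; a surjective `f` would put the new point in the
  -- base.
  obtain ⟨W, _, k, hk, hW, hX⟩ := exists_small_model hκ he.mem_right (range e ∪ {n})
    ((Cardinal.mk_union_le _ _).trans (Cardinal.add_le_of_le hκ0
      (Cardinal.mk_range_le.trans hA.le) ((Cardinal.mk_singleton _).le.trans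
        (Cardinal.one_le_aleph0.trans hκ0))))
  obtain ⟨e', he', rfl⟩ := hk.exists_factor he fun b => hX _ (Or.inl ⟨b, rfl⟩)
  obtain ⟨w, hw⟩ := hX _ (Or.inr rfl)
  obtain ⟨g, hg, hgf⟩ := hf.2.2 W e' he'
    ((hW.trans hA.symm.le).antisymm (card_le_of_embedding e'))
  obtain ⟨a, ha⟩ := hs (g w)
  rw [← hgf] at ha
  exact hn ⟨a, by rw [← hw, ← g.injective ha]; rfl⟩

end Stable

/-! ### Invariance under isomorphism, and existence of limit models -/

theorem IsUniversalExt.of_equiv {A B A' B' : Type u} [L.Structure A] [L.Structure B]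
    [L.Structure A'] [L.Structure B'] {f : A ↪[L] B} (hf : K.IsUniversalExt f)
    (a : A ≃[L] A') (b : B ≃[L] B') {f' : A' ↪[L] B'}
    (h : ∀ x, f' (a x) = b (f x)) : K.IsUniversalExt f' := by
  have hA' := K.mem_iso a hf.1.mem_left
  have hf' : f' = (b.toEmbedding.comp f).comp a.symm.toEmbedding := by
    ext x
    obtain ⟨y, rfl⟩ := a.surjective x
    rw [h]
    change b (f y) = b (f (a.symm (a y)))
    rw [a.symm_apply_apply]
  have hb := isKEmbedding_equiv b hf.1.mem_right
  have hcard : #A = #A' := Cardinal.mk_congr a.toEquiv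
  refine ⟨hf' ▸ (hb.comp hf.1).comp (isKEmbedding_equiv a.symm hA'), ?_, fun N _ k hk hN => ?_⟩
  · rw [← hcard, hf.2.1]
    exact Cardinal.mk_congr b.toEquiv
  · obtain ⟨g, hg, hgk⟩ := hf.2.2 N (k.comp a.toEmbedding)
      (hk.comp (isKEmbedding_equiv a hf.1.mem_left)) (hN.trans hcard.symm)
    refine ⟨b.toEmbedding.comp g, hb.comp hg, ?_⟩
    ext x
    obtain ⟨y, rfl⟩ := a.surjective x
    rw [h, ← hgk]
    rfl

theorem IsLimitModel.of_equiv {ν : Cardinal.{u}} {θ : Ordinal.{u}} {M N : Type u} [L.Structure M]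
    [L.Structure N] (hM : K.IsLimitModel ν θ M) (e : M ≃[L] N) : K.IsLimitModel ν θ N := by
  obtain ⟨hθ, S, hS, hlt, hlim, huniv, htop⟩ := hM
  let T : Ordinal.{u} → L.Substructure N := fun i => (S i).map e.toEmbedding.toHom
  have hmem : ∀ i x, e x ∈ T i ↔ x ∈ S i := fun i x =>
    ⟨fun ⟨y, hy, hyx⟩ => e.injective hyx ▸ hy, fun hx => ⟨x, hx, rfl⟩⟩
  have hle : ∀ i j, S i ≤ S j → T i ≤ T j := by
    rintro i j h _ ⟨x, hx, rfl⟩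
    exact ⟨x, h hx, rfl⟩
  let r : ∀ i, S i ≃[L] T i := fun i => e.toEmbedding.substructureEquivMap (S i)
  have hr : ∀ i x, (r i x : N) = e x := fun i x => rfl
  refine ⟨hθ, T, fun i hi => ⟨K.mem_iso (r i) (hS i hi).1, ?_⟩, fun i j hij hj => ⟨?_, ?_⟩,
    fun i hi hl => ?_, fun i hi => ?_, ?_⟩
  · rw [← (hS i hi).2]
    exact (Cardinal.mk_congr (r i).toEquiv).symm
  · refine lt_of_le_not_ge (hle i j (hlt i j hij hj).1.le) fun h => ?_
    refine (hlt i j hij hj).1.not_ge fun x hx => ?_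
    exact (hmem i x).1 (h ((hmem j x).2 hx))
  · refine (strong_mono_iso (r j) _ _ fun x => ?_).1 (hlt i j hij hj).2
    exact (hmem i x).symm
  · ext y
    obtain ⟨x, rfl⟩ := e.surjective y
    have := Set.ext_iff.1 (hlim i hi hl) x
    simpa [hmem] using this
  · obtain ⟨h, hu⟩ := huniv i hi
    exact ⟨hle _ _ h, hu.of_equiv (r i) (r (succ i)) fun x => rfl⟩
  · ext y
    obtain ⟨x, rfl⟩ := e.surjective y
    have := Set.ext_iff.1 htop x
    simpa [hmem] using this

open ModelIn in
/-- Existence of `(κ, κ)`-limit models. -/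
theorem exists_isLimitModel (hAP : K.AmalgamationProperty) {κ : Cardinal.{u}} (hκ : K.LS ≤ κ)
    (hstab : K.GaloisStable κ) (hmax : K.NoMaximalModel κ) {A : Type u} [L.Structure A]
    (hA : K.Mem A) (hc : #A = κ) :
    ∃ (N : Type u) (_ : L.Structure N), K.IsLimitModel κ κ.ord N := by
  have hκ0 := (LS_spec K).1.trans hκ
  have hU : κ < #(succ κ).out := by
    rw [Cardinal.mk_out]
    exact Order.lt_succ κ
  obtain ⟨A₀, ⟨g₀⟩⟩ := exists_copy (U := (succ κ).out) hA (hc.le.trans hU.le)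
  have hA₀ : #A₀.carrier = κ := (Cardinal.mk_congr g₀.toEquiv).symm.trans hc
  obtain ⟨S, hmono, -, hInv, hR, hcont⟩ := exists_transfinite_chain κ.ord
    (fun _ (B : ModelIn K (succ κ).out) => #B.carrier = κ)
    (fun _ p q => ∃ h : p ≤ q, K.IsUniversalExt (incl h)) (fun B => B.carrier) A₀ hA₀
    (by
      intro i hi p hp
      obtain ⟨q, h, hq⟩ := exists_universalExt hAP hκ hstab hU p hp
      exact ⟨q, h, hq.2.1.symm.trans hp, h, hq⟩)
    (by
      intro δ hδ hl S hS hInv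
      obtain ⟨T, hT, hTc⟩ := exists_union hl S hS
      exact ⟨T, hT, (card_union hκ0 hδ hTc fun i hi => (hInv i hi).le).antisymm
        ((hInv 0 hl.bot_lt).symm.le.trans (card_le_of_embedding (incl (hT 0 hl.bot_lt)))), hTc⟩)
  have hl : IsSuccLimit κ.ord := Cardinal.isSuccLimit_ord hκ0
  let d : ∀ i : Iio κ.ord, (S i).carrier ↪[L] (S κ.ord).carrier :=
    fun i => incl (hmono (mem_Iio.1 i.2).le)
  have hd : ∀ i (hi : i < κ.ord) (x : (S κ.ord).carrier),
      x ∈ rangeSeq d i ↔ (x : (succ κ).out) ∈ (S i).carrier := by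
    intro i hi x
    rw [rangeSeq_of_lt d hi, mem_range_embedding]
    constructor
    · rintro ⟨a, rfl⟩
      rw [incl_coe]
      exact a.2
    · exact fun hx => ⟨⟨x, hx⟩, Subtype.ext (incl_coe _ _)⟩
  have hr : ∀ i (hi : i < κ.ord), ∃ r : (S i).carrier ≃[L] rangeSeq d i,
      ∀ x, ((r x : (S κ.ord).carrier) : (succ κ).out) = x := by
    intro i hi
    rw [rangeSeq_of_lt d hi]
    exact ⟨(d ⟨i, hi⟩).equivRange, fun x => incl_coe _ _⟩
  have hch := rangeSeq_chain (K := K) d fun i j hij =>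
    ⟨incl (hmono hij), isK_incl _, incl_comp_incl _ _⟩
  refine ⟨(S κ.ord).carrier, inferInstance, hl, rangeSeq d, fun i hi => ?_,
    fun i j hij hj => ⟨?_, (hch i j hij hj).2⟩, fun i hi hil => ?_, fun i hi => ?_, ?_⟩
  · obtain ⟨r, -⟩ := hr i hi
    exact ⟨K.mem_iso r (S i).mem, (Cardinal.mk_congr r.toEquiv).symm.trans (hInv i hi.le)⟩
  -- If `S j` were contained in `S i`, so would be `S (succ i)`, and the universal step from `S i`
  -- would be surjective.
  · refine lt_of_le_not_ge (hch i j hij hj).1 fun h => ?_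
    have hi : i < κ.ord := hij.trans hj
    obtain ⟨hle, hu⟩ := hR i hi
    refine hu.not_surjective hκ hmax (hInv i hi.le) fun y => ?_
    have hy : (y : (succ κ).out) ∈ (S j).carrier :=
      carrier_subset (hmono (Order.succ_le_of_lt hij)) y.2
    have hyt := carrier_subset (hmono hj.le) hy
    exact ⟨⟨y, (hd i hi ⟨y, hyt⟩).1 (h ((hd j hj ⟨y, hyt⟩).2 hy))⟩, Subtype.ext (incl_coe _ _)⟩
  · ext x
    rw [SetLike.mem_coe, hd i hi, hcont i hi.le hil]
    simp only [mem_iUnion, SetLike.mem_coe, exists_prop, mem_Iio]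
    exact exists_congr fun j => and_congr_right fun hj => (hd j (hj.trans hi) x).symm
  · obtain ⟨hle, hu⟩ := hR i hi
    obtain ⟨r, hrx⟩ := hr i hi
    obtain ⟨r', hrx'⟩ := hr (succ i) (hl.succ_lt hi)
    refine ⟨(hch i (succ i) (Order.lt_succ i) (hl.succ_lt hi)).1,
      hu.of_equiv r r' fun x => Subtype.ext (Subtype.ext ?_)⟩
    rw [hrx', incl_coe]
    exact hrx x
  · refine eq_univ_of_forall fun x => ?_
    have hx := (Set.ext_iff.1 (hcont _ le_rfl hl) (x : (succ κ).out)).1 x.2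
    simp only [mem_iUnion, SetLike.mem_coe, exists_prop, mem_Iio] at hx ⊢
    exact hx.imp fun i hi => ⟨hi.1, (hd i hi.1 x).2 hi.2⟩

/-! ### Model homogeneity and size of limit models -/

/-- `M` is model homogeneous for models of size at most `μ`. -/
def IsModelHomogeneous (K : AEC L) (μ : Cardinal.{u}) (M : Type u) [L.Structure M] : Prop :=
  ∀ (A B : Type u) [L.Structure A] [L.Structure B] (f : A ↪[L] M) (e : A ↪[L] B),
    K.IsKEmbedding f → K.IsKEmbedding e → #B ≤ μ →
    ∃ g : B ↪[L] M, K.IsKEmbedding g ∧ g.comp e = f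

/-- The chain axiom upgrades strength between members of the chain to strength in `M`. -/
theorem IsLimitModel.strong_chain {ν : Cardinal.{u}} {θ : Ordinal.{u}} {M : Type u} [L.Structure M]
    (hM : K.IsLimitModel ν θ M) : K.Mem M ∧ ∃ S : Ordinal.{u} → L.Substructure M,
      (∀ i < θ, K.Strong (S i) ∧ #(S i) = ν) ∧ (∀ i j, i < j → j < θ → S i < S j) ∧
      (∀ i < θ, ∃ h : S i ≤ S (succ i),
        K.IsUniversalExt (FirstOrder.Language.Substructure.inclusion h)) ∧
      ∀ x, ∃ i < θ, x ∈ S i := by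
  obtain ⟨hθ, S, hS, hlt, -, huniv, htop⟩ := hM
  have h := K.chain_union θ hθ S (fun i j hij hj => ⟨(hlt i j hij hj).1.le, (hlt i j hij hj).2⟩) htop
  refine ⟨h.1, S, fun i hi => ⟨h.2 i hi, (hS i hi).2⟩, fun i j hij hj => (hlt i j hij hj).1,
    huniv, fun x => ?_⟩
  have := Set.ext_iff.1 htop x
  simpa using this

theorem IsLimitModel.isModelHomogeneous (hAP : K.AmalgamationProperty) {μ ν : Cardinal.{u}}
    (hμ : K.LS ≤ μ) (hμν : μ ≤ ν) {M : Type u} [L.Structure M]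
    (hM : K.IsLimitModel ν (succ μ).ord M) : K.IsModelHomogeneous μ M := by
  have hμ0 := (LS_spec K).1.trans hμ
  have hl : IsSuccLimit (succ μ).ord := hM.1
  obtain ⟨-, S, hS, hlt, huniv, hx⟩ := hM.strong_chain
  intro A B _ _ f e hf he hB
  choose i hi hxi using fun a => hx (f a)
  have hA : #A ≤ μ := (card_le_of_embedding e).trans hB
  -- At most `μ` indices are bounded below the regular cardinal `μ⁺`, so one member of the chain
  -- contains all of `f[A]`.
  have hj : (⨆ a, i a) < (succ μ).ord := by
    refine Ordinal.iSup_lt_of_lt_cof ?_ hi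
    rw [(Cardinal.isRegular_succ hμ0).cof_ord]
    exact Order.lt_succ_iff.2 hA
  have hij := Ordinal.le_iSup i
  generalize ⨆ a, i a = j at hj hij
  have hfj : ∀ a, f a ∈ S j := by
    intro a
    rcases (hij a).lt_or_eq with h | h
    · exact (hlt _ _ h hj).le (hxi a)
    · exact h ▸ hxi a
  obtain ⟨h, hu⟩ := huniv j hj
  obtain ⟨f', hf', rfl⟩ := (isKEmbedding_subtype (hS j hj).1).exists_factor hf
    fun a => ⟨⟨f a, hfj a⟩, rfl⟩
  obtain ⟨W, _, p, q, hp, hq, hW, hpq⟩ := exists_small_amalgam hAP (hμ.trans hμν) hf' he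
    (hS j hj).2.le (hB.trans hμν)
  obtain ⟨g, hg, hgp⟩ := hu.2.2 W p hp
    (le_antisymm (hW.trans (hS j hj).2.ge) (card_le_of_embedding p))
  have hs := isKEmbedding_subtype (hS (succ j) (hl.succ_lt hj)).1
  refine ⟨((S (succ j)).subtype.comp g).comp q, (hs.comp hg).comp hq, ?_⟩
  ext a
  have h1 : p (f' a) = q (e a) := DFunLike.congr_fun hpq a
  have h2 := DFunLike.congr_fun hgp (f' a)
  change ((g (q (e a)) : S (succ j)) : M) = f' a
  rw [← h1]
  exact congrArg Subtype.val h2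

/-- The upper bound counts a union of `μ⁺` sets of size at most `μ⁺`; for the lower bound,
strictness supplies a new point at each step. -/
theorem IsLimitModel.card_eq {μ ν : Cardinal.{u}} (hμ : ℵ₀ ≤ μ) (hν : ν ≤ succ μ) {M : Type u}
    [L.Structure M] (hM : K.IsLimitModel ν (succ μ).ord M) : #M = succ μ := by
  have hl : IsSuccLimit (succ μ).ord := hM.1
  obtain ⟨-, S, hS, hlt, -, hx⟩ := hM.strong_chain
  apply le_antisymm
  · have h := mk_biUnion_Iio_le (hμ.trans (Order.le_succ μ)) (Cardinal.card_ord (succ μ)).le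
      (fun i => (S i : Set M)) fun i hi => (hS i hi).2.le.trans hν
    have h' : (⋃ i ∈ Iio (succ μ).ord, (S i : Set M)) = Set.univ :=
      eq_univ_of_forall fun x => by
        obtain ⟨i, hi, hxi⟩ := hx x
        exact mem_iUnion₂.2 ⟨i, hi, hxi⟩
    rwa [h', Cardinal.mk_univ] at h
  · have hy : ∀ i : Iio (succ μ).ord, ∃ y, y ∈ S (succ i.1) ∧ y ∉ S i.1 := fun i =>
      SetLike.exists_of_lt (hlt i.1 _ (Order.lt_succ _) (hl.succ_lt i.2))
    choose y hy1 hy2 using hy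
    have hne : ∀ i j, i < j → y i ≠ y j := by
      intro i j hij h
      refine hy2 j (h ▸ ?_)
      rcases (Order.succ_le_of_lt (show i.1 < j.1 from hij)).lt_or_eq with h | h
      · exact (hlt _ _ h j.2).le (hy1 i)
      · exact h ▸ hy1 i
    have hinj : Function.Injective y := fun i j h => by
      rcases lt_trichotomy i j with h' | h' | h'
      · exact (hne _ _ h' h).elim
      · exact h'
      · exact (hne _ _ h' h.symm).elim
    have := Cardinal.mk_le_of_injective (Equiv.ulift.symm.injective.comp hinj :
      Function.Injective ((Equiv.ulift.{u + 1}.symm : M ≃ _) ∘ y))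
    rwa [Cardinal.mk_Iio_ordinal, Cardinal.card_ord, Cardinal.mk_uLift, Cardinal.lift_le] at this

/-! ### Back-and-forth between model homogeneous models -/

/-- A pair of `K`-embeddings of a common model in `M` and `N`, seen as a partial isomorphism. -/
structure Span (K : AEC L) (M N : Type u) [L.Structure M] [L.Structure N] where
  /-- the common model -/
  A : Type u
  /-- its structure -/
  [str : L.Structure A]
  /-- the left embedding -/
  f : A ↪[L] M
  /-- the right embedding -/
  g : A ↪[L] N
  isK_left : K.IsKEmbedding f
  isK_right : K.IsKEmbedding g

namespace Span

attribute [instance] Span.str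

variable {M N : Type u} [L.Structure M] [L.Structure N]

instance : Preorder (Span K M N) where
  le p q := ∃ h : p.A ↪[L] q.A, (∀ a, q.f (h a) = p.f a) ∧ ∀ a, q.g (h a) = p.g a
  le_refl p := ⟨.refl L _, fun _ => rfl, fun _ => rfl⟩
  le_trans p q r := fun ⟨h, h1, h2⟩ ⟨k, k1, k2⟩ =>
    ⟨k.comp h, fun a => (k1 _).trans (h1 a), fun a => (k2 _).trans (h2 a)⟩

/-- The inverse partial isomorphism. -/
def swap (p : Span K M N) : Span K N M := ⟨p.A, p.g, p.f, p.isK_right, p.isK_left⟩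

theorem swap_le {p q : Span K M N} (h : p ≤ q) : p.swap ≤ q.swap :=
  h.imp fun _ h => ⟨h.2, h.1⟩

/-- Löwenheim–Skolem enlarges the domain inside `M` to contain `x`, and homogeneity of `N` extends
the right embedding. Applied to `swap`, it gives the back step. -/
theorem exists_forth {μ : Cardinal.{u}} (hμ : K.LS ≤ μ) (hN : K.IsModelHomogeneous μ N)
    (p : Span K M N) (hp : #p.A ≤ μ) (x : M) :
    ∃ q : Span K M N, p ≤ q ∧ #q.A ≤ μ ∧ ∃ y, q.f y = x := by
  have hμ0 := (LS_spec K).1.trans hμ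
  obtain ⟨W, _, k, hk, hW, hX⟩ := exists_small_model hμ p.isK_left.mem_right (range p.f ∪ {x})
    ((Cardinal.mk_union_le _ _).trans (Cardinal.add_le_of_le hμ0
      (Cardinal.mk_range_le.trans hp) ((Cardinal.mk_singleton _).le.trans
        (Cardinal.one_le_aleph0.trans hμ0))))
  obtain ⟨e, he, hke⟩ := hk.exists_factor p.isK_left fun b => hX _ (Or.inl ⟨b, rfl⟩)
  obtain ⟨g, hg, hge⟩ := hN p.A W p.g e p.isK_right he hW
  exact ⟨⟨W, k, g, hk, hg⟩, ⟨e, DFunLike.congr_fun hke, DFunLike.congr_fun hge⟩, hW,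
    hX _ (Or.inr rfl)⟩

theorem exists_back_and_forth {μ : Cardinal.{u}} (hμ : K.LS ≤ μ) (hM : K.IsModelHomogeneous μ M)
    (hN : K.IsModelHomogeneous μ N) (p : Span K M N) (hp : #p.A ≤ μ) (x : M) (x' : N) :
    ∃ q : Span K M N, p ≤ q ∧ #q.A ≤ μ ∧ (∃ y, q.f y = x) ∧ ∃ y, q.g y = x' := by
  obtain ⟨q, hpq, hq, y, rfl⟩ := exists_forth hμ hN p hp x
  obtain ⟨r, hqr, hr, y', rfl⟩ := exists_forth hμ hM q.swap hq x'
  have h : q ≤ r.swap := swap_le hqr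
  refine ⟨r.swap, hpq.trans h, hr, ?_, y', rfl⟩
  obtain ⟨e, he, -⟩ := h
  exact ⟨e y, he y⟩

/-- The union of the left images in `M` carries the limit structure, onto which both families of
embeddings glue. -/
theorem exists_union {δ : Ordinal.{u}} (hδ : IsSuccLimit δ) (S : Ordinal.{u} → Span K M N)
    (hS : ∀ i j, i ≤ j → j < δ → S i ≤ S j) :
    ∃ T : Span K M N, (∀ i < δ, S i ≤ T) ∧ #T.A = #(⋃ i ∈ Iio δ, range (S i).f : Set M) := by
  have hne : Nonempty (Iio δ) := ⟨⟨0, hδ.bot_lt⟩⟩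
  let D : Set M := ⋃ i ∈ Iio δ, range (S i).f
  let d : ∀ i : Iio δ, (S i).A → D := fun i x => ⟨(S i).f x, mem_iUnion₂.2 ⟨i.1, i.2, x, rfl⟩⟩
  have hsurj : ∀ x, ∃ i a, d i a = x := by
    rintro ⟨x, hx⟩
    obtain ⟨i, hi, a, rfl⟩ := mem_iUnion₂.1 hx
    exact ⟨⟨i, hi⟩, a, rfl⟩
  choose h hf hg using fun (i j : Iio δ) (hij : i ≤ j) => hS i j hij j.2
  have hh : ∀ i j hij, K.IsKEmbedding (h i j hij) := fun i j hij => by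
    refine (S j).isK_left.of_comp ?_
    have : (S j).f.comp (h i j hij) = (S i).f := by
      ext a
      exact hf i j hij a
    exact this ▸ (S i).isK_left
  obtain ⟨str, he⟩ := exists_union_structure (L := L) d
    (fun i x y hxy => (S i).f.injective (congrArg (fun z : D => (z : M)) hxy))
    (fun i j hij => ⟨h i j hij, fun a => Subtype.ext (hf i j hij a)⟩) hsurj
  choose e he using he
  have hed : ∀ i j hij a, e j (h i j hij a) = e i a := fun i j hij a => by
    rw [he, he]
    exact Subtype.ext (hf i j hij a)
  have hes : ∀ x, ∃ i a, e i a = x := fun x => by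
    obtain ⟨i, a, ha⟩ := hsurj x
    exact ⟨i, a, (he i a).trans ha⟩
  obtain ⟨F, hF, hFc⟩ := exists_glue_isKEmbedding hδ e (fun i => (S i).f)
    (fun i => (S i).isK_left)
    (fun i j hij => ⟨h i j hij, hh i j hij, hed i j hij, hf i j hij⟩) hes
  obtain ⟨G, hG, hGc⟩ := exists_glue_isKEmbedding hδ e (fun i => (S i).g)
    (fun i => (S i).isK_right)
    (fun i j hij => ⟨h i j hij, hh i j hij, hed i j hij, hg i j hij⟩) hes
  exact ⟨⟨D, F, G, hF, hG⟩, fun i hi => ⟨e ⟨i, hi⟩, hFc ⟨i, hi⟩, hGc ⟨i, hi⟩⟩, rfl⟩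

end Span

/-- Uniqueness of model homogeneous models of size `μ⁺`. -/
theorem IsModelHomogeneous.nonempty_equiv {M N : Type u} [L.Structure M] [L.Structure N]
    {μ : Cardinal.{u}} (hμ : K.LS ≤ μ) (hJEP : K.JointEmbeddingProperty)
    (hM : K.IsModelHomogeneous μ M) (hN : K.IsModelHomogeneous μ N) (hmM : K.Mem M)
    (hmN : K.Mem N) (hcM : #M = succ μ) (hcN : #N = succ μ) : Nonempty (M ≃[L] N) := by
  have hμ0 := (LS_spec K).1.trans hμ
  have hne : ∀ {X : Type u}, #X = succ μ → Nonempty X := fun h => Cardinal.mk_ne_zero_iff.1 (by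
    rw [h]
    exact (Order.bot_lt_succ μ).ne')
  have := hne hcM
  have := hne hcN
  obtain ⟨a, ha⟩ := exists_enumeration_small hcM.le
  obtain ⟨b, hb⟩ := exists_enumeration_small hcN.le
  -- Small submodels of `M` and `N` are jointly embedded in `W`, and homogeneity of `N` sends `W`
  -- into `N` over the second one.
  obtain ⟨p₀, hp₀⟩ : ∃ p : Span K M N, #p.A ≤ μ := by
    obtain ⟨A, _, f, hf, hA, -⟩ := exists_small_model hμ hmM ∅ (by simp)
    obtain ⟨B, _, g, hg, hB, -⟩ := exists_small_model hμ hmN ∅ (by simp)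
    obtain ⟨W, _, i, j, hi, hj, hW⟩ := exists_small_joint hJEP hμ hf.mem_left hg.mem_left hA hB
    obtain ⟨k, hk, -⟩ := hN B W g j hg hj hW
    exact ⟨⟨A, f, k.comp i, hf, hk.comp hi⟩, hA⟩
  obtain ⟨S, hmono, -, -, hR, -⟩ := exists_transfinite_chain (X := M) (succ μ).ord
    -- The size bound is claimed only below `μ⁺`: the last span has size `μ⁺`.
    (fun i (p : Span K M N) => i < (succ μ).ord → #p.A ≤ μ)
    (fun i _ q => (∃ y, q.f y = a i) ∧ ∃ y, q.g y = b i) (fun _ => ∅) p₀ (fun _ => hp₀)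
    (by
      intro i hi p hp
      obtain ⟨q, hpq, hq, h⟩ := Span.exists_back_and_forth hμ hM hN p (hp hi) (a i) (b i)
      exact ⟨q, hpq, fun _ => hq, h⟩)
    (by
      intro δ hδ hl S hS hInv
      obtain ⟨T, hT, hTc⟩ := Span.exists_union hl S hS
      refine ⟨T, hT, fun hδ' => ?_, by simp⟩
      rw [hTc]
      exact mk_biUnion_Iio_le hμ0 (Order.lt_succ_iff.1 (Cardinal.lt_ord.1 hδ')) _
        fun i hi => Cardinal.mk_range_le.trans (hInv i hi (hi.trans hδ')))
  have hf : Function.Surjective (S (succ μ).ord).f := fun x => by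
    obtain ⟨i, hi, rfl⟩ := ha x
    obtain ⟨⟨y, hy⟩, -⟩ := hR i hi
    obtain ⟨h, hh, -⟩ := hmono (Order.succ_le_of_lt hi)
    exact ⟨h y, (hh y).trans hy⟩
  have hg : Function.Surjective (S (succ μ).ord).g := fun x => by
    obtain ⟨i, hi, rfl⟩ := hb x
    obtain ⟨-, y, hy⟩ := hR i hi
    obtain ⟨h, -, hh⟩ := hmono (Order.succ_le_of_lt hi)
    exact ⟨h y, (hh y).trans hy⟩
  have key : ∀ {X Y : Type u} [L.Structure X] [L.Structure Y] (k : X ↪[L] Y),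
      Function.Surjective k → Nonempty (X ≃[L] Y) := fun k hk =>
    ⟨{ Equiv.ofBijective k ⟨k.injective, hk⟩ with
      map_fun' := k.map_fun'
      map_rel' := k.map_rel' }⟩
  obtain ⟨e⟩ := key _ hf
  obtain ⟨e'⟩ := key _ hg
  exact ⟨e'.comp e.symm⟩

end AEC

/-! ### The theorem -/

theorem mainTheorem6 {L : FirstOrder.Language.{u, u}} (K : AEC L) (μ : Cardinal.{u})
    (hLS : K.LS ≤ μ)
    (hAP : K.AmalgamationProperty) (hJEP : K.JointEmbeddingProperty)
    (hmax : K.NoMaximalModel (Order.succ μ))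
    (hstab : K.GaloisStable (Order.succ μ))
    (M : Type u) [L.Structure M]
    (hM : K.IsLimitModel μ (Order.succ μ).ord M) :
    K.IsLimitModel (Order.succ μ) (Order.succ μ).ord M := by
  have hμ0 := (AEC.LS_spec K).1.trans hLS
  have hμ := Order.le_succ μ
  have hcM := hM.card_eq hμ0 hμ
  -- `M` has size `μ⁺` and serves as the starting model; the resulting `N` is compared with `M` only
  -- through homogeneity.
  obtain ⟨N, _, hN⟩ := AEC.exists_isLimitModel hAP (hLS.trans hμ) hstab hmax
    hM.strong_chain.1 hcM
  obtain ⟨e⟩ := (hN.isModelHomogeneous hAP hLS hμ).nonempty_equiv hLS hJEP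
    (hM.isModelHomogeneous hAP hLS le_rfl) hN.strong_chain.1 hM.strong_chain.1
    (hN.card_eq hμ0 le_rfl) hcM
  exact hN.of_equiv e
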